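/- An edge-coloring of a finite simple graph $G$ (adjacent edges may receive the same color) makes $G$ rainbow connected if every two vertices of $G$ are joined by a path whose edges have pairwise distinct colors. For a connected graph $G$, the rainbow connection number $rc(G)$ is the smallest number of colors in an edge-coloring that makes $G$ rainbow connected. A graph is 2-connected if it has at least three vertices, is connected, and remains connected after the deletion of any single vertex. **Theorem.** Let $G$ be a 2-connected graph of order $n \geq 3$. Then $rc(G) \leq \lceil n/2 \rceil$. This bound is sharp for every $n \geq 4$: the cycle $C_n$ is a 2-connected graph of order $n$ with $rc(C_n) = \lceil n/2 \rceil$. -/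

import Mathlib

namespace RainbowConnection

/-- A graph is 2-connected if it has at least three vertices, is connected, and remains connected
after the deletion of any one vertex. -/
structure TwoConnected {V : Type*} [Fintype V] (G : SimpleGraph V) : Prop where
  three_le_card : 3 ≤ Fintype.card V
  connected : G.Connected
  connected_delete : ∀ v : V, (G.induce {v}ᶜ).Connected

/-- A path in an edge-coloured graph is a rainbow path if no two of its edges have the same
colour. -/
def IsRainbowPath {V K : Type*} {G : SimpleGraph V} (c : G.EdgeLabeling K) {u v : V}
    (p : G.Walk u v) : Prop :=
  p.IsPath ∧ ∀ e f : G.edgeSet, e.1 ∈ p.edges → f.1 ∈ p.edges → c e = c f → e = f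

/-- An edge-colouring (adjacent edges may share a colour) makes `G` rainbow connected if every
pair of vertices is joined by a rainbow path. -/
def IsRainbowConnected {V K : Type*} {G : SimpleGraph V} (c : G.EdgeLabeling K) : Prop :=
  ∀ u v : V, ∃ p : G.Walk u v, IsRainbowPath c p

/-- The rainbow connection number: the least number `k` of colours for which some edge-colouring
with colours from a `k`-element set makes `G` rainbow connected
(it is `⊤` if there is no such `k`). -/
noncomputable def rc {V : Type*} (G : SimpleGraph V) : ℕ∞ :=
  ⨅ (k : ℕ) (_ : ∃ c : G.EdgeLabeling (Fin k), IsRainbowConnected c), (k : ℕ∞)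

end RainbowConnection

/-!
The upper bound is proved by induction along ear decompositions, with two strengthened induction
hypotheses according to the parity of the number of vertices.

An ear with `2m` inner vertices costs `m` new colours: colour its edges
`c₁ … cₘ z c₁ … cₘ` with any old colour `z`. A vertex of the first half leaves the ear through
`c₁ … cᵢ` and one of the second half through `cⱼ … cₘ`, and two vertices whose ways out share a
colour are joined by a rainbow stretch of the ear. An ear with `2m + 1` inner vertices can always be
coloured with `m + 1` new colours, but on a graph of odd order only `m` are available. It is then
coloured `c₁ … cₘ x z c₁ … cₘ` with two old colours, and the middle vertex reaches the old vertices
if the left end reaches all of them without using `x`. The invariant `OddGood G S t r` therefore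
provides, in odd order, a colouring in which a prescribed vertex `t` never needs some colour `x`;
moreover a second prescribed vertex `r` reaches all vertices but one while missing some colour.

To produce `OddGood` from a set of even order by an ear coloured `c₁ … cₘ α x c₁ … cₘ`, with `x`
new, the vertex `t` has to reach one of the two ends of the ear while missing an old colour `α`
(`IsEar.oddGood_of_odd`). In a set of even order built by an ear, `t` has such slack to all vertices
but two neighbouring inner vertices of that ear, unless the ear has a single inner vertex
(`IsEar.evenSlack_of_even`, `IsEar.evenSlack_of_odd`). If the ends of the new ear are just the two
exceptional vertices, the new ear is spliced into the previous one, which gives a simpler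
decomposition. If the previous ear has a single inner vertex, the two ears are merged or
interchanged, or both have a single inner vertex and are coloured together
(`IsEar.oddGood_of_two`); it is here that the second vertex `r` of `OddGood` is needed. All this
takes place in `oddGood_of_even_base`. The induction needs `t` and `r` to survive in the smaller
sets, so the decompositions start from a cycle through both (`NoCut.exists_decomposition`).

For the cycle `Cₙ` the lower bound comes from lifting walks to the integers: with fewer than
`⌈n/2⌉` colours one must have `n = 2m + 1` and `m` colours, and then the colour of an edge is
repeated at distance `m`, hence on neighbouring edges.
-/

namespace RainbowConnection

open Set

section

variable {V : Type*} {G : SimpleGraph V}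

/-! ### Rainbow walks with a prescribed set of colours -/

/-- `Link G c S D u v`: some walk of `G` from `u` to `v` stays inside `S`, repeats no colour and
uses only colours from `D`. Walks are used instead of paths because they can be concatenated
freely; a rainbow walk always contains a rainbow path. The colouring is defined on all of
`Sym2 V`, so that it makes sense to recolour and extend it. -/
def Link (G : SimpleGraph V) (c : Sym2 V → ℕ) (S : Set V) (D : Set ℕ) (u v : V) : Prop :=
  ∃ p : G.Walk u v, (∀ x ∈ p.support, x ∈ S) ∧ (p.edges.map c).Nodup ∧ ∀ e ∈ p.edges, c e ∈ D

namespace Link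

variable {c c' : Sym2 V → ℕ} {S S' : Set V} {D D' D₁ D₂ : Set ℕ} {u v w : V}

lemma refl (hu : u ∈ S) : Link G c S D u u := ⟨.nil, by simpa, by simp, by simp⟩

lemma symm (h : Link G c S D u v) : Link G c S D v u := by
  obtain ⟨p, h1, h2, h3⟩ := h
  exact ⟨p.reverse, by simpa using h1, by simpa [List.map_reverse] using h2, by simpa using h3⟩

lemma mono (h : Link G c S D u v) (hD : ∀ q ∈ D, q ∈ D') : Link G c S D' u v := by
  obtain ⟨p, h1, h2, h3⟩ := h
  exact ⟨p, h1, h2, fun e he => hD _ (h3 e he)⟩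

lemma trans (h : Link G c S D₁ u v) (h' : Link G c S D₂ v w) (hd : ∀ q ∈ D₁, q ∉ D₂)
    (h₁ : ∀ q ∈ D₁, q ∈ D) (h₂ : ∀ q ∈ D₂, q ∈ D) : Link G c S D u w := by
  obtain ⟨p, p1, p2, p3⟩ := h
  obtain ⟨r, r1, r2, r3⟩ := h'
  refine ⟨p.append r, ?_, ?_, ?_⟩
  · intro x hx
    rcases (SimpleGraph.Walk.mem_support_append_iff _ _).1 hx with hx | hx
    exacts [p1 x hx, r1 x hx]
  · rw [SimpleGraph.Walk.edges_append, List.map_append, List.nodup_append']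
    refine ⟨p2, r2, ?_⟩
    intro q hq hq'
    obtain ⟨e, he, rfl⟩ := List.mem_map.1 hq
    obtain ⟨e', he', h⟩ := List.mem_map.1 hq'
    exact hd _ (p3 e he) (h ▸ r3 e' he')
  · intro e he
    rw [SimpleGraph.Walk.edges_append, List.mem_append] at he
    rcases he with he | he
    exacts [h₁ _ (p3 e he), h₂ _ (r3 e he)]

lemma of_adj (h : G.Adj u v) (hu : u ∈ S) (hv : v ∈ S) (hD : c s(u, v) ∈ D) :
    Link G c S D u v :=
  ⟨h.toWalk, by simp [hu, hv], by simp, by simpa⟩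

/-- A link survives any change of the colouring outside the edges spanned by `S`. -/
lemma extend (h : Link G c S D u v) (hS : S ⊆ S')
    (hc : ∀ x ∈ S, ∀ y ∈ S, c' s(x, y) = c s(x, y)) : Link G c' S' D u v := by
  obtain ⟨p, h1, h2, h3⟩ := h
  have key : ∀ e ∈ p.edges, c' e = c e := by
    intro e
    induction e with
    | _ x y =>
      intro he
      exact hc x (h1 x (p.fst_mem_support_of_mem_edges he)) y
        (h1 y (p.snd_mem_support_of_mem_edges he))
  refine ⟨p, fun x hx => hS (h1 x hx), ?_, fun e he => by rw [key e he]; exact h3 e he⟩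
  rwa [List.map_congr_left key]

end Link

/-- Every two vertices of `S` are joined by a rainbow walk in `S` with fewer than `K` colours
available. -/
def RainbowOn (G : SimpleGraph V) (c : Sym2 V → ℕ) (S : Set V) (K : ℕ) : Prop :=
  ∀ u ∈ S, ∀ v ∈ S, Link G c S (Iio K) u v

/-- `u` and `v` are joined by a rainbow walk in `S` that misses at least one of the `K` colours. -/
def Slack (G : SimpleGraph V) (c : Sym2 V → ℕ) (S : Set V) (K : ℕ) (u v : V) : Prop :=
  ∃ α < K, Link G c S (Iio K \ {α}) u v

/-! ### Ears and their colourings -/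

/-- `X 0, X 1, …, X (k + 1)` is an ear on `S` with `k ≥ 1` inner vertices: a path of `G` whose
two ends are distinct vertices of `S` and whose inner vertices lie outside `S`. The values of `X`
beyond `k + 1` are irrelevant. -/
structure IsEar (G : SimpleGraph V) (S : Finset V) (X : ℕ → V) (k : ℕ) : Prop where
  pos : 1 ≤ k
  adj : ∀ i ≤ k, G.Adj (X i) (X (i + 1))
  inj : ∀ i j, i < j → j ≤ k + 1 → X i ≠ X j
  left : X 0 ∈ S
  right : X (k + 1) ∈ S
  out : ∀ i, 1 ≤ i → i ≤ k → X i ∉ S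

open Classical in
/-- The set `S` together with the inner vertices of an ear. -/
noncomputable def earUnion (S : Finset V) (X : ℕ → V) (k : ℕ) : Finset V :=
  S ∪ (Finset.Icc 1 k).image X

open Classical in
/-- The colouring that gives the `i`-th edge `X i X (i + 1)` of an ear the colour `f i` and agrees
with `c` on all other edges. -/
noncomputable def earColor (c : Sym2 V → ℕ) (X : ℕ → V) (k : ℕ) (f : ℕ → ℕ) (e : Sym2 V) : ℕ :=
  if h : ∃ i ≤ k, e = s(X i, X (i + 1)) then f h.choose else c e

variable {S : Finset V} {X : ℕ → V} {k : ℕ} {c : Sym2 V → ℕ} {f : ℕ → ℕ}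

lemma subset_earUnion : S ⊆ earUnion S X k := fun _ hv => by
  simp [earUnion, hv]

lemma mem_earUnion {v : V} :
    v ∈ earUnion S X k ↔ v ∈ S ∨ ∃ i, 1 ≤ i ∧ i ≤ k ∧ X i = v := by
  simp [earUnion, and_assoc]

lemma mem_earUnion_of_mem {v : V} (h : v ∈ S) : v ∈ earUnion S X k := subset_earUnion h

namespace IsEar

lemma apply_mem_earUnion (h : IsEar G S X k) {i : ℕ} (hi : i ≤ k + 1) : X i ∈ earUnion S X k := by
  rw [mem_earUnion]
  rcases Nat.eq_zero_or_pos i with rfl | h0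
  · exact .inl h.left
  · rcases hi.eq_or_lt with rfl | h1
    · exact .inl h.right
    · exact .inr ⟨i, h0, by omega, rfl⟩

lemma card_earUnion (h : IsEar G S X k) : (earUnion S X k).card = S.card + k := by
  classical
  have hinj : Set.InjOn X (Finset.Icc 1 k : Finset ℕ) := by
    intro i hi j hj hij
    simp only [Finset.coe_Icc, Set.mem_Icc] at hi hj
    by_contra hne
    rcases Nat.lt_or_gt_of_ne hne with hl | hl
    · exact h.inj i j hl (by omega) hij
    · exact h.inj j i hl (by omega) hij.symm
  have hdisj : Disjoint S ((Finset.Icc 1 k).image X) := by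
    rw [Finset.disjoint_left]
    intro v hv hv'
    obtain ⟨i, hi, rfl⟩ := Finset.mem_image.1 hv'
    rw [Finset.mem_Icc] at hi
    exact h.out i hi.1 hi.2 hv
  have : earUnion S X k = S ∪ (Finset.Icc 1 k).image X := by unfold earUnion; congr
  rw [this, Finset.card_union_of_disjoint hdisj, Finset.card_image_of_injOn hinj]
  simp

lemma ends_ne (h : IsEar G S X k) : X 0 ≠ X (k + 1) := h.inj _ _ (by omega) le_rfl

/-- The ear traversed from its other end. -/
lemma reverse (h : IsEar G S X k) : IsEar G S (fun i => X (k + 1 - i)) k where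
  pos := h.pos
  adj i hi := by
    have := (h.adj (k - i) (by omega)).symm
    rwa [show k - i + 1 = k + 1 - i by omega, show k - i = k + 1 - (i + 1) by omega] at this
  inj i j hij hj := (h.inj (k + 1 - j) (k + 1 - i) (by omega) (by omega)).symm
  left := by simpa using h.right
  right := by simpa using h.left
  out i h1 h2 := h.out _ (by omega) (by omega)

lemma earUnion_reverse : earUnion S (fun i => X (k + 1 - i)) k = earUnion S X k := by
  ext v
  simp only [mem_earUnion]
  refine or_congr_right ⟨?_, ?_⟩
  · rintro ⟨i, h1, h2, rfl⟩
    exact ⟨k + 1 - i, by omega, by omega, rfl⟩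
  · rintro ⟨i, h1, h2, rfl⟩
    exact ⟨k + 1 - i, by omega, by omega, by congr 1; omega⟩

lemma earColor_edge (h : IsEar G S X k) {i : ℕ} (hi : i ≤ k) :
    earColor c X k f s(X i, X (i + 1)) = f i := by
  have hex : ∃ j ≤ k, s(X i, X (i + 1)) = s(X j, X (j + 1)) := ⟨i, hi, rfl⟩
  unfold earColor
  rw [dif_pos hex]
  obtain ⟨h1, h2⟩ := hex.choose_spec
  set j := hex.choose
  congr 1
  have ne : ∀ a b, a ≤ k + 1 → b ≤ k + 1 → X a = X b → a = b := by
    intro a b ha hb hab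
    by_contra hne
    rcases Nat.lt_or_gt_of_ne hne with hl | hl
    · exact h.inj a b hl hb hab
    · exact h.inj b a hl ha hab.symm
  rw [Sym2.eq_iff] at h2
  rcases h2 with ⟨h2, -⟩ | ⟨h2, h3⟩
  · exact (ne _ _ (by omega) (by omega) h2).symm
  · have := ne _ _ (by omega) (by omega) h2
    have := ne _ _ (by omega) (by omega) h3
    omega

lemma earColor_of_mem (h : IsEar G S X k) {x y : V} (hx : x ∈ S) (hy : y ∈ S) :
    earColor c X k f s(x, y) = c s(x, y) := by
  unfold earColor
  rw [dif_neg]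
  rintro ⟨i, hi, he⟩
  have hmem : ∀ z ∈ s(x, y), z ∈ S := by simp [hx, hy]
  rw [he] at hmem
  rcases Nat.eq_zero_or_pos i with rfl | h0
  · exact h.out 1 le_rfl h.pos (hmem (X (0 + 1)) (by simp))
  · exact h.out i h0 hi (hmem (X i) (by simp))

lemma link_extend (h : IsEar G S X k) {D : Set ℕ} {u v : V} (hl : Link G c S D u v) :
    Link G (earColor c X k f) (earUnion S X k) D u v :=
  hl.extend (by exact_mod_cast subset_earUnion) fun _ hx _ hy => h.earColor_of_mem hx hy

/-- A stretch of the ear on which the colours are distinct. -/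
lemma link_along (h : IsEar G S X k) {D : Set ℕ} {i j : ℕ} (hij : i ≤ j) (hj : j ≤ k + 1)
    (hf : ∀ a b, i ≤ a → a < b → b < j → f a ≠ f b) (hD : ∀ a, i ≤ a → a < j → f a ∈ D) :
    Link G (earColor c X k f) (earUnion S X k) D (X i) (X j) := by
  suffices H : Link G (earColor c X k f) (earUnion S X k) {q | ∃ a, i ≤ a ∧ a < j ∧ f a = q}
      (X i) (X j) by
    refine H.mono ?_
    rintro q ⟨a, h1, h2, rfl⟩
    exact hD a h1 h2
  clear hD
  induction j, hij using Nat.le_induction with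
  | base => exact .refl (by exact_mod_cast h.apply_mem_earUnion hj)
  | succ j hij ih =>
    refine (ih (by omega) fun a b h1 h2 h3 => hf a b h1 h2 (by omega)).trans
      (D₂ := {f j}) (Link.of_adj (h.adj j (by omega)) ?_ ?_ ?_) ?_ ?_ ?_
    · exact_mod_cast h.apply_mem_earUnion (by omega)
    · exact_mod_cast h.apply_mem_earUnion (by omega)
    · rw [h.earColor_edge (by omega)]; rfl
    · rintro q ⟨a, h1, h2, rfl⟩ h3
      exact hf a j h1 h2 (by omega) h3
    · rintro q ⟨a, h1, h2, rfl⟩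
      exact ⟨a, h1, by omega, rfl⟩
    · rintro q rfl
      exact ⟨j, hij, by omega, rfl⟩

end IsEar

end

section

variable {V : Type*} {G : SimpleGraph V}
variable {S : Finset V} {X : ℕ → V} {k : ℕ} {c : Sym2 V → ℕ} {f : ℕ → ℕ}

/-! ### Ears coloured in two halves -/

/-- The colour pattern `K, K+1, …, K+m-1, mid 0, …, mid (g-1), K, K+1, …, K+m-1` on the `2m + g`
edges of an ear: `m` new colours, each used once in either half, around `g` middle edges. A vertex
of the first half reaches the left end through the first `i` new colours, its opposite in the
second half reaches the right end through the complementary ones. -/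
def halves (K m g : ℕ) (mid : ℕ → ℕ) (i : ℕ) : ℕ :=
  if i < m then K + i else if i < m + g then mid (i - m) else K + (i - m - g)

namespace IsEar

variable {K m g K' : ℕ} {mid : ℕ → ℕ}

lemma link_left (h : IsEar G S X k) (hk : k + 1 = 2 * m + g) {i j : ℕ} (hij : i ≤ j)
    (hj : j ≤ m) :
    Link G (earColor c X k (halves K m g mid)) (earUnion S X k) {q | K + i ≤ q ∧ q < K + j}
      (X i) (X j) := by
  refine h.link_along hij (by omega) (fun a b h1 h2 h3 => ?_) fun a h1 h2 => ?_
  · simp only [halves, if_pos (show a < m by omega), if_pos (show b < m by omega)]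
    omega
  · simp only [halves, if_pos (show a < m by omega), mem_ofPred_eq]
    omega

lemma link_right (h : IsEar G S X k) (hk : k + 1 = 2 * m + g) {i j : ℕ} (hij : i ≤ j)
    (hj : j ≤ m) :
    Link G (earColor c X k (halves K m g mid)) (earUnion S X k) {q | K + i ≤ q ∧ q < K + j}
      (X (m + g + i)) (X (m + g + j)) := by
  refine h.link_along (by omega) (by omega) (fun a b h1 h2 h3 => ?_) fun a h1 h2 => ?_
  · simp only [halves, if_neg (show ¬ a < m by omega), if_neg (show ¬ b < m by omega),
      if_neg (show ¬ a < m + g by omega), if_neg (show ¬ b < m + g by omega)]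
    omega
  · simp only [halves, if_neg (show ¬ a < m by omega), if_neg (show ¬ a < m + g by omega),
      mem_ofPred_eq]
    omega

lemma link_across (h : IsEar G S X k) (hk : k + 1 = 2 * m + g)
    (hmid : ∀ a < g, mid a < K ∨ K + m ≤ mid a) (hinj : ∀ a b, a < b → b < g → mid a ≠ mid b)
    {i j : ℕ} (hji : j ≤ i) (hi : i ≤ m) :
    Link G (earColor c X k (halves K m g mid)) (earUnion S X k)
      {q | (K + i ≤ q ∧ q < K + m) ∨ (K ≤ q ∧ q < K + j) ∨ ∃ a < g, mid a = q} (X i) (X (m + g + j)) := by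
  refine h.link_along (by omega) (by omega) (fun a b h1 h2 h3 => ?_) fun a h1 h2 => ?_
  · simp only [halves]
    have A := hmid (a - m)
    have B := hmid (b - m)
    have C := hinj (a - m) (b - m)
    split_ifs <;> omega
  · simp only [halves, mem_ofPred_eq]
    split_ifs
    · omega
    · exact .inr (.inr ⟨a - m, by omega, rfl⟩)
    · omega

lemma link_from_left (h : IsEar G S X k) (hk : k + 1 = 2 * m + g) {D : Set ℕ} {u : V}
    (hl : Link G c S D u (X 0)) (hD : ∀ q ∈ D, q < K) {i : ℕ} (hi : i ≤ m) :
    Link G (earColor c X k (halves K m g mid)) (earUnion S X k)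
      {q | q ∈ D ∨ (K ≤ q ∧ q < K + i)} u (X i) := by
  refine (h.link_extend hl).trans (h.link_left hk (Nat.zero_le i) hi) ?_ ?_ ?_
  · intro q hq hq'
    have := hD q hq
    simp only [mem_ofPred_eq] at hq'
    omega
  · exact fun q hq => .inl hq
  · exact fun q hq => .inr hq

lemma link_from_right (h : IsEar G S X k) (hk : k + 1 = 2 * m + g) {D : Set ℕ} {u : V}
    (hl : Link G c S D u (X (k + 1))) (hD : ∀ q ∈ D, q < K) {j : ℕ} (hj : j ≤ m) :
    Link G (earColor c X k (halves K m g mid)) (earUnion S X k)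
      {q | q ∈ D ∨ (K + j ≤ q ∧ q < K + m)} u (X (m + g + j)) := by
  have := (h.link_right (c := c) (K := K) (mid := mid) hk hj le_rfl).symm
  rw [show m + g + m = k + 1 by omega] at this
  refine (h.link_extend hl).trans this ?_ ?_ ?_
  · intro q hq hq'
    have := hD q hq
    simp only [mem_ofPred_eq] at hq'
    omega
  · exact fun q hq => .inl hq
  · exact fun q hq => .inr hq

/-- The pattern `halves` joins any two vertices other than the inner vertices of the middle
stretch. Two vertices in different halves use the ear or the two ends, whichever avoids
repeating a new colour. -/
lemma link_outer (h : IsEar G S X k) (hk : k + 1 = 2 * m + g) (hR : RainbowOn G c S K)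
    (hmid : ∀ a < g, mid a < K ∨ K + m ≤ mid a) (hinj : ∀ a b, a < b → b < g → mid a ≠ mid b)
    (hK : K + m ≤ K') (hmid' : ∀ a < g, mid a < K') {u v : V}
    (hu : u ∈ S ∨ ∃ i ≤ m, X i = u ∨ X (m + g + i) = u)
    (hv : v ∈ S ∨ ∃ i ≤ m, X i = v ∨ X (m + g + i) = v) :
    Link G (earColor c X k (halves K m g mid)) (earUnion S X k) (Iio K') u v := by
  have hLR : ∀ i ≤ m, ∀ j ≤ m, Link G (earColor c X k (halves K m g mid)) (earUnion S X k)
      (Iio K') (X i) (X (m + g + j)) := by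
    intro i hi j hj
    rcases le_total j i with hji | hij
    · refine (h.link_across hk hmid hinj hji hi).mono ?_
      rintro q (hq | hq | ⟨a, ha, rfl⟩)
      · exact lt_of_lt_of_le hq.2 hK
      · simp only [mem_Iio]; omega
      · exact hmid' a ha
    · refine (h.link_from_left (K := K) hk (hR _ h.right _ h.left) (fun q hq => hq) hi).symm.trans
        (h.link_right (i := j) hk hj le_rfl |>.symm.mono (D' := {q | K + j ≤ q ∧ q < K + m})
          (fun q hq => hq) |> fun H => by
            rwa [show m + g + m = k + 1 by omega] at H) ?_ ?_ ?_
      · rintro q (hq | hq) hq' <;> simp only [mem_ofPred_eq, mem_Iio] at * <;> omega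
      · rintro q (hq | hq) <;> simp only [mem_Iio] at * <;> omega
      · rintro q hq; simp only [mem_ofPred_eq, mem_Iio] at *; omega
  have hSL : ∀ u ∈ S, ∀ i ≤ m, Link G (earColor c X k (halves K m g mid)) (earUnion S X k)
      (Iio K') u (X i) := fun u hu i hi =>
    (h.link_from_left hk (hR _ hu _ h.left) (fun q hq => hq) hi).mono <| by
      rintro q (hq | hq) <;> simp only [mem_Iio] at * <;> omega
  have hSR : ∀ u ∈ S, ∀ i ≤ m, Link G (earColor c X k (halves K m g mid)) (earUnion S X k)
      (Iio K') u (X (m + g + i)) := fun u hu i hi =>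
    (h.link_from_right hk (hR _ hu _ h.right) (fun q hq => hq) hi).mono <| by
      rintro q (hq | hq) <;> simp only [mem_Iio] at * <;> omega
  have hLL : ∀ i ≤ m, ∀ j ≤ m, Link G (earColor c X k (halves K m g mid)) (earUnion S X k)
      (Iio K') (X i) (X j) := by
    intro i hi j hj
    rcases le_total i j with hij | hij
    · exact (h.link_left hk hij hj).mono fun q hq => by
        simp only [mem_ofPred_eq, mem_Iio] at *; omega
    · exact (h.link_left hk hij hi).symm.mono fun q hq => by
        simp only [mem_ofPred_eq, mem_Iio] at *; omega
  have hRR : ∀ i ≤ m, ∀ j ≤ m, Link G (earColor c X k (halves K m g mid)) (earUnion S X k)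
      (Iio K') (X (m + g + i)) (X (m + g + j)) := by
    intro i hi j hj
    rcases le_total i j with hij | hij
    · exact (h.link_right hk hij hj).mono fun q hq => by
        simp only [mem_ofPred_eq, mem_Iio] at *; omega
    · exact (h.link_right hk hij hi).symm.mono fun q hq => by
        simp only [mem_ofPred_eq, mem_Iio] at *; omega
  rcases hu with hu | ⟨i, hi, rfl | rfl⟩ <;> rcases hv with hv | ⟨j, hj, rfl | rfl⟩
  · exact (h.link_extend (hR _ hu _ hv)).mono fun q hq => by
      simp only [mem_Iio] at *; omega
  · exact hSL _ hu _ hj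
  · exact hSR _ hu _ hj
  · exact (hSL _ hv _ hi).symm
  · exact hLL _ hi _ hj
  · exact hLR _ hi _ hj
  · exact (hSR _ hv _ hi).symm
  · exact (hLR _ hj _ hi).symm
  · exact hRR _ hi _ hj

/-- Vertices of an enlarged set, sorted by their position on the ear. -/
lemma cases_mem (hk : k + 1 = 2 * m + g) {v : V} (hv : v ∈ earUnion S X k) :
    v ∈ S ∨ (∃ i, 1 ≤ i ∧ i ≤ m ∧ X i = v) ∨ (∃ i, m < i ∧ i < m + g ∧ X i = v) ∨
      ∃ j < m, X (m + g + j) = v := by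
  rcases mem_earUnion.1 hv with hv | ⟨i, h1, h2, rfl⟩
  · exact .inl hv
  · by_cases h3 : i ≤ m
    · exact .inr (.inl ⟨i, h1, h3, rfl⟩)
    by_cases h4 : i < m + g
    · exact .inr (.inr (.inl ⟨i, by omega, h4, rfl⟩))
    · exact .inr (.inr (.inr ⟨i - (m + g), by omega, by congr 1; omega⟩))

/-- An ear with `2m` inner vertices costs `m` new colours. -/
lemma rainbowOn_even (h : IsEar G S X k) (hk : k = 2 * m) (hR : RainbowOn G c S K) (hK : 0 < K) :
    RainbowOn G (earColor c X k (halves K m 1 fun _ => 0)) (earUnion S X k) (K + m) := by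
  have hout : ∀ v ∈ earUnion S X k, v ∈ S ∨ ∃ i ≤ m, X i = v ∨ X (m + 1 + i) = v := by
    intro v hv
    rcases cases_mem (m := m) (g := 1) (by omega) hv with
      hv | ⟨i, -, hi, rfl⟩ | ⟨i, h1, h2, rfl⟩ | ⟨j, hj, rfl⟩
    · exact .inl hv
    · exact .inr ⟨i, hi, .inl rfl⟩
    · omega
    · exact .inr ⟨j, hj.le, .inr rfl⟩
  intro u hu v hv
  exact h.link_outer (by omega) hR (fun _ _ => .inl hK) (by omega) le_rfl (fun _ _ => by omega)
    (hout u hu) (hout v hv)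

/-- The colours of the two middle edges of an ear with an odd number of inner vertices. -/
def twoMid (α β : ℕ) (i : ℕ) : ℕ := if i = 0 then α else β

lemma link_mid_left (h : IsEar G S X k) (hk : k = 2 * m + 1) {α β i : ℕ}
    (hα : α < K ∨ K + m ≤ α) (hi : i ≤ m) :
    Link G (earColor c X k (halves K m 2 (twoMid α β))) (earUnion S X k)
      {q | q = α ∨ (K + i ≤ q ∧ q < K + m)} (X (m + 1)) (X i) := by
  refine (h.link_along (by omega) (by omega) (fun a b h1 h2 h3 => ?_) fun a h1 h2 => ?_).symm
  · simp only [halves, twoMid]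
    split_ifs <;> omega
  · simp only [halves, twoMid, mem_ofPred_eq]
    split_ifs <;> omega

lemma link_mid_right (h : IsEar G S X k) (hk : k = 2 * m + 1) {α β j : ℕ}
    (hβ : β < K ∨ K + m ≤ β) (hj : j ≤ m) :
    Link G (earColor c X k (halves K m 2 (twoMid α β))) (earUnion S X k)
      {q | q = β ∨ (K ≤ q ∧ q < K + j)} (X (m + 1)) (X (m + 2 + j)) := by
  refine h.link_along (by omega) (by omega) (fun a b h1 h2 h3 => ?_) fun a h1 h2 => ?_
  · simp only [halves, twoMid]
    split_ifs <;> omega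
  · simp only [halves, twoMid, mem_ofPred_eq]
    split_ifs <;> omega

/-- An ear with `2m + 1` inner vertices and middle colours `α`, `β`: the middle vertex needs, for
each old vertex `v`, a walk to `v` from the left end avoiding `α` or from the right end
avoiding `β`. -/
lemma rainbowOn_odd (h : IsEar G S X k) (hk : k = 2 * m + 1) (hR : RainbowOn G c S K) {α β : ℕ}
    (hα : α < K ∨ K + m ≤ α) (hβ : β < K ∨ K + m ≤ β) (hαβ : α ≠ β) (hα' : α < K') (hβ' : β < K')
    (hK : K + m ≤ K')
    (hy : ∀ v ∈ S, Link G c S (Iio K \ {α}) (X 0) v ∨ Link G c S (Iio K \ {β}) (X (k + 1)) v) :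
    RainbowOn G (earColor c X k (halves K m 2 (twoMid α β))) (earUnion S X k) K' := by
  have hout : ∀ v ∈ earUnion S X k,
      X (m + 1) = v ∨ v ∈ S ∨ ∃ i ≤ m, X i = v ∨ X (m + 2 + i) = v := by
    intro v hv
    rcases cases_mem (m := m) (g := 2) (by omega) hv with
      hv | ⟨i, -, hi, rfl⟩ | ⟨i, h1, h2, rfl⟩ | ⟨j, hj, rfl⟩
    · exact .inr (.inl hv)
    · exact .inr (.inr ⟨i, hi, .inl rfl⟩)
    · exact .inl (by congr 1; omega)
    · exact .inr (.inr ⟨j, hj.le, .inr rfl⟩)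
  have hmidv : ∀ v, (v ∈ S ∨ ∃ i ≤ m, X i = v ∨ X (m + 2 + i) = v) →
      Link G (earColor c X k (halves K m 2 (twoMid α β))) (earUnion S X k) (Iio K')
        (X (m + 1)) v := by
    rintro v (hv | ⟨i, hi, rfl | rfl⟩)
    · rcases hy v hv with hv | hv
      · refine (h.link_mid_left hk hα (Nat.zero_le m)).trans (h.link_extend hv) ?_ ?_ ?_
        · rintro q (rfl | hq) hq' <;> simp at * ; omega
        · rintro q (rfl | hq) <;> simp at * <;> omega
        · intro q hq; simp at *; omega
      · have := h.link_mid_right (c := c) (K := K) (α := α) hk hβ le_rfl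
        rw [show m + 2 + m = k + 1 by omega] at this
        refine this.trans (h.link_extend hv) ?_ ?_ ?_
        · rintro q (rfl | hq) hq' <;> simp at * ; omega
        · rintro q (rfl | hq) <;> simp at * <;> omega
        · intro q hq; simp at *; omega
    · refine (h.link_mid_left hk hα hi).mono ?_
      rintro q (rfl | hq) <;> simp at * <;> omega
    · refine (h.link_mid_right hk hβ hi).mono ?_
      rintro q (rfl | hq) <;> simp at * <;> omega
  intro u hu v hv
  rcases hout u hu with rfl | hu <;> rcases hout v hv with rfl | hv
  · exact .refl (by exact_mod_cast h.apply_mem_earUnion (by omega))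
  · exact hmidv v hv
  · exact (hmidv u hu).symm
  · refine h.link_outer (by omega) hR ?_ ?_ hK ?_ hu hv
    · intro a ha; simp only [twoMid]; split_ifs <;> assumption
    · intro a b h1 h2; simp only [twoMid]; split_ifs <;> omega
    · intro a ha; simp only [twoMid]; split_ifs <;> assumption

end IsEar

end

section

variable {V : Type*} {G : SimpleGraph V}
variable {S : Finset V} {X : ℕ → V} {k : ℕ} {c : Sym2 V → ℕ} {f : ℕ → ℕ}

/-! ### The two invariants -/

/-- The invariant for sets of even order `2K`: a rainbow colouring with `K` colours in which `t`
reaches every vertex of `U` while missing some colour. -/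
def EvenSlack (G : SimpleGraph V) (S : Finset V) (t : V) (U : Set V) : Prop :=
  ∃ K c, S.card = 2 * K ∧ RainbowOn G c S K ∧ ∀ u ∈ U, Slack G c S K t u

/-- The invariant for sets of odd order `2K - 1`: a rainbow colouring with `K` colours in which
`t` reaches everything without using one fixed colour `x`, and in which `r` reaches every vertex,
except possibly one, while missing some colour (which may depend on the vertex). -/
def OddGood (G : SimpleGraph V) (S : Finset V) (t r : V) : Prop :=
  ∃ K c, S.card + 1 = 2 * K ∧ RainbowOn G c S K ∧
    (∃ x < K, ∀ v ∈ S, Link G c S (Iio K \ {x}) t v) ∧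
    ∃ v₀, ∀ v ∈ S, v ≠ v₀ → Slack G c S K r v

variable {t r : V} {U : Set V} {m : ℕ}

lemma EvenSlack.mono {U' : Set V} (h : EvenSlack G S t U) (hU : ∀ u ∈ U', u ∈ U) :
    EvenSlack G S t U' := by
  obtain ⟨K, c, h1, h2, h3⟩ := h
  exact ⟨K, c, h1, h2, fun u hu => h3 u (hU u hu)⟩

lemma evenSlack_pair (hS : S.card = 2) (hadj : ∀ u ∈ S, ∀ v ∈ S, u ≠ v → G.Adj u v) (ht : t ∈ S) :
    EvenSlack G S t {t} := by
  refine ⟨1, fun _ => 0, by omega, ?_, ?_⟩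
  · intro u hu v hv
    by_cases huv : u = v
    · subst huv; exact .refl hu
    · exact .of_adj (hadj u hu v hv huv) hu hv (by simp)
  · rintro u rfl
    exact ⟨0, by simp, .refl ht⟩

namespace IsEar

/-- Extending by an ear with `2m` inner vertices: an old vertex misses some colour on its way to
all vertices but the two middle ones of the ear. -/
lemma evenSlack_of_even (h : IsEar G S X k) (hk : k = 2 * m) (hS : EvenSlack G S t U)
    (ht : t ∈ S) :
    EvenSlack G (earUnion S X k) t
      {u | u ∈ earUnion S X k ∧ u ≠ X m ∧ u ≠ X (m + 1)} := by
  obtain ⟨K, c, h1, h2, -⟩ := hS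
  have hcard : 0 < S.card := Finset.card_pos.2 ⟨t, ht⟩
  have hpos := h.pos
  refine ⟨K + m, _, ?_, h.rainbowOn_even hk h2 (by omega), ?_⟩
  · rw [h.card_earUnion]; omega
  rintro u ⟨hu, hne, hne'⟩
  rcases cases_mem (m := m) (g := 1) (by omega) hu with
    hu | ⟨i, -, hi, rfl⟩ | ⟨i, hi1, hi2, rfl⟩ | ⟨j, hj, rfl⟩
  · refine ⟨K, by omega, (h.link_extend (h2 t ht u hu)).mono fun q hq => ?_⟩
    simp at *; omega
  · have : i ≠ m := by rintro rfl; exact hne rfl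
    refine ⟨K + m - 1, by omega, (h.link_from_left (by omega) (h2 _ ht _ h.left)
      (fun q hq => hq) hi).mono ?_⟩
    rintro q (hq | hq) <;> simp at * <;> omega
  · omega
  · have : j ≠ 0 := by rintro rfl; exact hne' rfl
    refine ⟨K, by omega, (h.link_from_right (by omega) (h2 _ ht _ h.right)
      (fun q hq => hq) hj.le).mono ?_⟩
    rintro q (hq | hq) <;> simp at * <;> omega

/-- Extending by an ear with `2m` inner vertices preserves the odd invariant: the colour avoided
by `t` is kept, since on the ear it can occur only on the middle edge, which `t` never uses. -/
lemma oddGood_of_even (h : IsEar G S X k) (hk : k = 2 * m) (hS : OddGood G S t r)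
    (hr : r ∈ S) : OddGood G (earUnion S X k) t r := by
  obtain ⟨K, c, h1, h2, ⟨x, hx, h3⟩, v₀, h4⟩ := hS
  have hpos := h.pos
  refine ⟨K + m, _, ?_, h.rainbowOn_even hk h2 (by omega), ⟨x, by omega, ?_⟩, ?_⟩
  · rw [h.card_earUnion]; omega
  · intro u hu
    rcases cases_mem (m := m) (g := 1) (by omega) hu with
      hu | ⟨i, -, hi, rfl⟩ | ⟨i, hi1, hi2, rfl⟩ | ⟨j, hj, rfl⟩
    · refine (h.link_extend (h3 u hu)).mono fun q hq => ?_
      simp at *; omega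
    · refine (h.link_from_left (by omega) (h3 _ h.left) (fun q hq => hq.1) hi).mono ?_
      rintro q (hq | hq) <;> simp at * <;> omega
    · omega
    · refine (h.link_from_right (by omega) (h3 _ h.right) (fun q hq => hq.1) hj.le).mono ?_
      rintro q (hq | hq) <;> simp at * <;> omega
  · -- The exceptional vertex moves from an end of the ear to the middle vertex next to its half.
    classical
    refine ⟨if v₀ = X 0 then X m else X (m + 1), fun u hu hne => ?_⟩
    rcases cases_mem (m := m) (g := 1) (by omega) hu with
      hu | ⟨i, -, hi, rfl⟩ | ⟨i, hi1, hi2, rfl⟩ | ⟨j, hj, rfl⟩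
    · refine ⟨K, by omega, (h.link_extend (h2 r hr u hu)).mono fun q hq => ?_⟩
      simp at *; omega
    · by_cases him : i = m
      · subst him
        have hv₀ : X 0 ≠ v₀ := by
          rintro rfl; simp at hne
        obtain ⟨α, hα, hl⟩ := h4 _ h.left hv₀
        refine ⟨α, by omega, (h.link_from_left (by omega) hl (fun q hq => hq.1) hi).mono ?_⟩
        rintro q (hq | hq) <;> simp at * <;> omega
      · refine ⟨K + m - 1, by omega, (h.link_from_left (by omega) (h2 _ hr _ h.left)
          (fun q hq => hq) hi).mono ?_⟩
        rintro q (hq | hq) <;> simp at * <;> omega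
    · omega
    · by_cases hj0 : j = 0
      · subst hj0
        have hv₀ : X (k + 1) ≠ v₀ := by
          rintro rfl
          rw [if_neg h.ends_ne.symm] at hne
          exact hne rfl
        obtain ⟨α, hα, hl⟩ := h4 _ h.right hv₀
        refine ⟨α, by omega, (h.link_from_right (by omega) hl (fun q hq => hq.1) hj.le).mono ?_⟩
        rintro q (hq | hq) <;> simp at * <;> omega
      · refine ⟨K, by omega, (h.link_from_right (by omega) (h2 _ hr _ h.right)
          (fun q hq => hq) hj.le).mono ?_⟩
        rintro q (hq | hq) <;> simp at * <;> omega

/-- An ear with `2m + 1` inner vertices on a set of odd order costs only `m` new colours, because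
the colour `x` that the left end never needs is reused for its left middle edge. An old vertex `t`
misses a colour on its way to all vertices but two neighbouring ones of the ear. -/
lemma evenSlack_of_odd (h : IsEar G S X k) (hk : k = 2 * m + 1) (hS : OddGood G S (X 0) r)
    (ht : t ∈ S) :
    EvenSlack G (earUnion S X k) t
      {u | 1 ≤ m ∧ u ∈ earUnion S X k ∧ u ≠ X (m + 1) ∧ u ≠ X (m + 2)} := by
  obtain ⟨K, c, h1, h2, ⟨x, hx, h3⟩, -⟩ := hS
  have hcard : 1 < S.card := Finset.one_lt_card.2 ⟨_, h.left, _, h.right, h.ends_ne⟩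
  obtain ⟨z, hz, hzx⟩ : ∃ z < K, x ≠ z := by
    by_cases hx0 : x = 0
    · exact ⟨1, by omega, by omega⟩
    · exact ⟨0, by omega, by omega⟩
  refine ⟨K + m, _, ?_, h.rainbowOn_odd hk h2 (α := x) (β := z) (.inl hx) (.inl hz) hzx (by omega)
    (by omega) le_rfl fun v hv => .inl (h3 v hv), ?_⟩
  · rw [h.card_earUnion]; omega
  rintro u ⟨hm, hu, hne, hne'⟩
  rcases cases_mem (m := m) (g := 2) (by omega) hu with
    hu | ⟨i, -, hi, rfl⟩ | ⟨i, hi1, hi2, rfl⟩ | ⟨j, hj, rfl⟩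
  · refine ⟨K, by omega, (h.link_extend (h2 t ht u hu)).mono fun q hq => ?_⟩
    simp at *; omega
  · refine ⟨x, by omega, (h.link_from_left (by omega) (h3 _ ht).symm (fun q hq => hq.1) hi).mono ?_⟩
    rintro q (hq | hq) <;> simp at * <;> omega
  · obtain rfl : i = m + 1 := by omega
    exact absurd rfl hne
  · have : j ≠ 0 := by rintro rfl; exact hne' rfl
    refine ⟨K, by omega, (h.link_from_right (by omega) (h2 _ ht _ h.right)
      (fun q hq => hq) hj.le).mono ?_⟩
    rintro q (hq | hq) <;> simp at * <;> omega

/-- An ear with `2m + 1` inner vertices on a set of even order costs `m + 1` new colours. One of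
them is used on a single edge, and becomes the colour avoided by `t`; on the other side of the
middle vertex an old colour `α` is reused, which `t` misses on its way to the left end. The vertex `r` is an old one, or any vertex of the
cycle formed by the ear and a single edge. -/
lemma oddGood_of_odd (h : IsEar G S X k) (hk : k = 2 * m + 1) (hS : EvenSlack G S t {X 0})
    (ht : t ∈ S) (hr : r ∈ S ∨ (S.card = 2 ∧ r ∈ earUnion S X k)) :
    OddGood G (earUnion S X k) t r := by
  obtain ⟨K, c, h1, h2, h3⟩ := hS
  obtain ⟨α, hα, h3⟩ := h3 _ rfl
  have hR := h.rainbowOn_odd hk h2 (α := α) (β := K + m) (K' := K + m + 1) (.inl hα)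
    (.inr le_rfl) (by omega) (by omega) (by omega) (by omega)
    (fun v hv => .inr ((h2 _ h.right _ hv).mono fun q hq => by simp at *; omega))
  have hold : ∀ r ∈ S, ∀ v ∈ earUnion S X k, v ≠ X (m + 1) →
      Link G (earColor c X k (halves K m 2 (twoMid α (K + m)))) (earUnion S X k)
        (Iio (K + m + 1) \ {K + m}) r v := by
    intro r hr v hv hne
    rcases cases_mem (m := m) (g := 2) (by omega) hv with
      hu | ⟨i, -, hi, rfl⟩ | ⟨i, hi1, hi2, rfl⟩ | ⟨j, hj, rfl⟩
    · refine (h.link_extend (h2 r hr v hu)).mono fun q hq => ?_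
      simp at *; omega
    · refine (h.link_from_left (by omega) (h2 _ hr _ h.left) (fun q hq => hq) hi).mono ?_
      rintro q (hq | hq) <;> simp at * <;> omega
    · obtain rfl : i = m + 1 := by omega
      exact absurd rfl hne
    · refine (h.link_from_right (by omega) (h2 _ hr _ h.right) (fun q hq => hq) hj.le).mono ?_
      rintro q (hq | hq) <;> simp at * <;> omega
  refine ⟨K + m + 1, _, ?_, hR, ⟨K + m, by omega, ?_⟩, ?_⟩
  · rw [h.card_earUnion]; omega
  · intro v hv
    by_cases hne : v = X (m + 1)
    · subst hne
      refine (h.link_extend h3).trans (h.link_mid_left hk (.inl hα) (Nat.zero_le m)).symm ?_ ?_ ?_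
      · rintro q hq (rfl | hq') <;> simp at * ; omega
      · rintro q hq; simp at *; omega
      · rintro q (rfl | hq) <;> simp at * <;> omega
    · exact hold t ht v hv hne
  by_cases hr' : r ∈ S
  · exact ⟨X (m + 1), fun v hv hne => ⟨K + m, by omega, hold r hr' v hv hne⟩⟩
  obtain ⟨hS2, hr⟩ := hr.resolve_left hr'
  have hS' : ∀ v ∈ S, v = X 0 ∨ v = X (k + 1) := by
    classical
    have : ({X 0, X (k + 1)} : Finset V) = S := by
      refine Finset.eq_of_subset_of_card_le ?_ ?_
      · intro v hv
        simp only [Finset.mem_insert, Finset.mem_singleton] at hv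
        rcases hv with rfl | rfl
        exacts [h.left, h.right]
      · rw [Finset.card_pair h.ends_ne, hS2]
    intro v hv
    rw [← this] at hv
    simpa using hv
  have hS'' : ∀ v ∈ earUnion S X k,
      X (m + 1) = v ∨ (∃ i ≤ m, X i = v) ∨ ∃ i ≤ m, X (m + 2 + i) = v := by
    intro v hv
    rcases cases_mem (m := m) (g := 2) (by omega) hv with
      hu | ⟨i, -, hi, rfl⟩ | ⟨i, hi1, hi2, rfl⟩ | ⟨j, hj, rfl⟩
    · rcases hS' v hu with rfl | rfl
      · exact .inr (.inl ⟨0, by omega, rfl⟩)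
      · exact .inr (.inr ⟨m, le_rfl, by congr 1; omega⟩)
    · exact .inr (.inl ⟨i, hi, rfl⟩)
    · exact .inl (by congr 1; omega)
    · exact .inr (.inr ⟨j, hj.le, rfl⟩)
  -- If `S` is just an edge, vertices in different halves are joined along one of the two arcs of
  -- the cycle formed by this edge and the ear.
  have hLR : ∀ i ≤ m, ∀ j ≤ m,
      Slack G (earColor c X k (halves K m 2 (twoMid α (K + m)))) (earUnion S X k) (K + m + 1)
        (X i) (X (m + 2 + j)) := by
    intro i hi j hj
    rcases Nat.lt_or_ge j i with hji | hij
    · refine ⟨K + j, by omega, (h.link_across (by omega) ?_ ?_ hji.le hi).mono ?_⟩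
      · intro a ha; simp only [twoMid]; split_ifs <;> omega
      · intro a b hab hb; simp only [twoMid]; split_ifs <;> omega
      · rintro q (hq | hq | ⟨a, ha, rfl⟩)
        · simp at *; omega
        · simp at *; omega
        · simp only [twoMid, mem_sdiff, mem_Iio, mem_singleton_iff]
          split_ifs <;> omega
    · have := (h.link_right (c := c) (K := K) (g := 2) (mid := twoMid α (K + m)) (by omega)
        hj le_rfl).symm
      rw [show m + 2 + m = k + 1 by omega] at this
      refine ⟨K + m, by omega, (h.link_from_left (by omega) (h2 _ h.right _ h.left)
        (fun q hq => hq) hi).symm.trans this ?_ ?_ ?_⟩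
      · rintro q (hq | hq) hq' <;> simp at * <;> omega
      · rintro q (hq | hq) <;> simp at * <;> omega
      · intro q hq; simp at *; omega
  have hmL : ∀ i ≤ m,
      Slack G (earColor c X k (halves K m 2 (twoMid α (K + m)))) (earUnion S X k) (K + m + 1)
        (X (m + 1)) (X i) := fun i hi => by
    refine ⟨K + m, by omega, (h.link_mid_left hk (.inl hα) hi).mono ?_⟩
    rintro q (rfl | hq) <;> simp at * <;> omega
  have hmR : ∀ i ≤ m,
      Slack G (earColor c X k (halves K m 2 (twoMid α (K + m)))) (earUnion S X k) (K + m + 1)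
        (X (m + 1)) (X (m + 2 + i)) := fun i hi => by
    refine ⟨α, by omega, (h.link_mid_right hk (.inr le_rfl) hi).mono ?_⟩
    rintro q (rfl | hq) <;> simp at * <;> omega
  have hsymm : ∀ {u v}, Slack G (earColor c X k (halves K m 2 (twoMid α (K + m))))
      (earUnion S X k) (K + m + 1) u v → Slack G (earColor c X k (halves K m 2 (twoMid α (K + m))))
      (earUnion S X k) (K + m + 1) v u := by
    rintro u v ⟨a, ha, hl⟩
    exact ⟨a, ha, hl.symm⟩
  refine ⟨X (m + 1), fun v hv hne => ?_⟩
  rcases hS'' v hv with rfl | ⟨j, hj, rfl⟩ | ⟨j, hj, rfl⟩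
  · exact absurd rfl hne
  · rcases hS'' r hr with rfl | ⟨i, hi, rfl⟩ | ⟨i, hi, rfl⟩
    · exact hmL j hj
    · refine ⟨K + m, by omega, ?_⟩
      rcases le_total i j with hij | hij
      · refine (h.link_left (by omega) hij hj).mono fun q hq => ?_
        simp at *; omega
      · refine (h.link_left (by omega) hij hi).symm.mono fun q hq => ?_
        simp at *; omega
    · exact hsymm (hLR j hj i hi)
  · rcases hS'' r hr with rfl | ⟨i, hi, rfl⟩ | ⟨i, hi, rfl⟩
    · exact hmR j hj
    · exact hLR i hi j hj
    · refine ⟨K + m, by omega, ?_⟩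
      rcases le_total i j with hij | hij
      · refine (h.link_right (by omega) hij hj).mono fun q hq => ?_
        simp at *; omega
      · refine (h.link_right (by omega) hij hi).symm.mono fun q hq => ?_
        simp at *; omega

end IsEar

end

section

variable {V : Type*} {G : SimpleGraph V}
variable {S : Finset V} {X Y : ℕ → V} {k l : ℕ} {t r : V}

/-! ### Two ears with a single inner vertex each -/

namespace IsEar

/-- Two new vertices `X 1` and `Y 1`, each joined to two old ones, cost one new colour `w` on a set
of odd order. Both use `w` on one edge. The edge `X 0 X 1` gets the colour that `X 0` never needs,
so that `X 1` reaches `Y 1` through `Y 2`; the edge `Y 0 Y 1` gets a colour missed by `t` on its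
way to `Y 0`. -/
lemma oddGood_of_two_of_slack (h : IsEar G S X 1) (h' : IsEar G (earUnion S X 1) Y 1)
    {K : ℕ} {c : Sym2 V → ℕ} (h1 : S.card + 1 = 2 * K) (h2 : RainbowOn G c S K)
    {x : ℕ} (hx : x < K) (h3 : ∀ v ∈ S, Link G c S (Iio K \ {x}) (X 0) v)
    (h4 : Slack G c S K t (Y 0)) (hY2 : Y 2 ∈ S) (ht : t ∈ S) (hr : r ∈ S) :
    OddGood G (earUnion (earUnion S X 1) Y 1) t r := by
  obtain ⟨α, hα, h4⟩ := h4
  have hR₁ := h.rainbowOn_odd (m := 0) (K' := K + 1) rfl h2 (α := x) (β := K) (.inl hx)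
    (.inr le_rfl) (by omega) (by omega) (by omega) (by omega) (fun v hv => .inl (h3 v hv))
  have hS₁ : ∀ u ∈ S, ∀ v ∈ earUnion S X 1,
      Link G (earColor c X 1 (halves K 0 2 (twoMid x K))) (earUnion S X 1) (Iio K) u v := by
    intro u hu v hv
    rcases mem_earUnion.1 hv with hv | ⟨i, hi1, hi2, rfl⟩
    · exact h.link_extend (h2 u hu v hv)
    · obtain rfl : i = 1 := by omega
      refine (h.link_extend (h3 u hu).symm).trans
        (h.link_mid_left rfl (.inl hx) (Nat.zero_le 0)).symm ?_ ?_ ?_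
      · rintro q hq (rfl | hq') <;> simp at * ; omega
      · intro q hq; simp at *; omega
      · rintro q (rfl | hq) <;> simp at * <;> omega
  have hS₂ : ∀ u ∈ S, ∀ v ∈ earUnion (earUnion S X 1) Y 1, v ≠ Y 1 →
      Link G (earColor (earColor c X 1 (halves K 0 2 (twoMid x K))) Y 1
        (halves (K + 1) 0 2 (twoMid α K))) (earUnion (earUnion S X 1) Y 1)
        (Iio (K + 1) \ {K}) u v := by
    intro u hu v hv hne
    rcases mem_earUnion.1 hv with hv | ⟨i, hi1, hi2, rfl⟩
    · refine (h'.link_extend (hS₁ u hu v hv)).mono fun q hq => ?_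
      simp at *; omega
    · obtain rfl : i = 1 := by omega
      exact absurd rfl hne
  refine ⟨K + 1, _, ?_, h'.rainbowOn_odd (m := 0) (K := K + 1) (K' := K + 1) rfl hR₁
    (α := α) (β := K) (.inl (by omega)) (.inl (by omega)) (by omega) (by omega) (by omega) le_rfl
    (fun v hv => .inr ((hS₁ _ hY2 v hv).mono fun q hq => by simp at *; omega)),
    ⟨K, by omega, ?_⟩, Y 1, fun v hv hne => ⟨K, by omega, hS₂ r hr v hv hne⟩⟩
  · rw [h'.card_earUnion, h.card_earUnion]; omega
  · intro v hv
    by_cases hne : v = Y 1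
    · subst hne
      refine (h'.link_extend (h.link_extend h4)).trans
        (h'.link_mid_left (m := 0) rfl (.inl (by omega)) le_rfl).symm ?_ ?_ ?_
      · rintro q hq (rfl | hq') <;> simp at * ; omega
      · intro q hq; simp at *; omega
      · rintro q (rfl | hq) <;> simp at * <;> omega
    · exact hS₂ t ht v hv hne

lemma oddGood_of_two (h : IsEar G S X 1) (h' : IsEar G (earUnion S X 1) Y 1)
    (hS : OddGood G S (X 0) t) (hY0 : Y 0 ∈ S) (hY2 : Y 2 ∈ S) (ht : t ∈ S) (hr : r ∈ S) :
    OddGood G (earUnion (earUnion S X 1) Y 1) t r := by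
  obtain ⟨K, c, h1, h2, ⟨x, hx, h3⟩, v₀, h4⟩ := hS
  by_cases hv : Y 0 = v₀
  · have := oddGood_of_two_of_slack h h'.reverse h1 h2 hx h3
      (h4 (Y 2) hY2 (by rw [← hv]; exact h'.ends_ne.symm)) (by simpa) ht hr
    rwa [earUnion_reverse] at this
  · exact oddGood_of_two_of_slack h h' h1 h2 hx h3 (h4 _ hY0 hv) hY2 ht hr

/-! ### Rearranging two consecutive ears -/

/-- An ear that starts at the single inner vertex of the previous ear can be merged with it. -/
lemma merge (h : IsEar G S X 1) (h' : IsEar G (earUnion S X 1) Y l) (h0 : Y 0 = X 1)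
    (hl : Y (l + 1) ∈ S) :
    ∃ Z, IsEar G S Z (l + 1) ∧ earUnion S Z (l + 1) = earUnion (earUnion S X 1) Y l := by
  obtain ⟨a, ha, hadj, hne⟩ : ∃ a ∈ S, G.Adj a (Y 0) ∧ a ≠ Y (l + 1) := by
    rw [h0]
    by_cases hX : X 0 = Y (l + 1)
    · exact ⟨X 2, h.right, (h.adj 1 le_rfl).symm, by rw [← hX]; exact h.ends_ne.symm⟩
    · exact ⟨X 0, h.left, h.adj 0 (by omega), hX⟩
  have h0' : Y 0 ∉ S := by rw [h0]; exact h.out 1 le_rfl le_rfl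
  have hnot : ∀ i, 1 ≤ i → i ≤ l → Y i ∉ S := fun i hi hi' hm =>
    h'.out i hi hi' (mem_earUnion_of_mem hm)
  have hnot' : ∀ i ≤ l, Y i ∉ S := fun i hi => by
    rcases Nat.eq_zero_or_pos i with rfl | hi'
    exacts [h0', hnot i hi' hi]
  refine ⟨fun j => if j = 0 then a else Y (j - 1), ⟨by omega, ?_, ?_, ?_, ?_, ?_⟩, ?_⟩
  · intro i hi
    rcases i with _ | i
    · simpa using hadj
    · simpa using h'.adj i (by omega)
  · intro i j hij hj
    rcases j with _ | j
    · omega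
    rcases i with _ | i
    · simp only [↓reduceIte, Nat.add_eq_zero_iff, one_ne_zero, and_false, add_tsub_cancel_right]
      rintro rfl
      by_cases hjl : j = l + 1
      · exact hne (by rw [hjl])
      · exact hnot' j (by omega) ha
    · simpa using h'.inj i j (by omega) (by omega)
  · simpa using ha
  · simpa using hl
  · intro i hi hi'
    rw [if_neg (by omega)]
    exact hnot' _ (by omega)
  · ext v
    simp only [mem_earUnion]
    constructor
    · rintro (hv | ⟨i, hi, hi', rfl⟩)
      · exact .inl (.inl hv)
      · rw [if_neg (by omega)]
        by_cases hi1 : i = 1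
        · subst hi1; exact .inl (.inr ⟨1, le_rfl, le_rfl, h0.symm⟩)
        · exact .inr ⟨i - 1, by omega, by omega, rfl⟩
    · rintro ((hv | ⟨i, hi, hi', rfl⟩) | ⟨i, hi, hi', rfl⟩)
      · exact .inl hv
      · obtain rfl : i = 1 := by omega
        exact .inr ⟨1, le_rfl, by omega, by simpa using h0⟩
      · exact .inr ⟨i + 1, by omega, by omega, by simp⟩

/-- An ear whose ends are two neighbouring inner vertices of the previous ear can be spliced into
it. -/
lemma splice (h : IsEar G S X k) (h' : IsEar G (earUnion S X k) Y l) {i : ℕ} (hi : 1 ≤ i)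
    (hik : i + 1 ≤ k) (h0 : Y 0 = X i) (hl : Y (l + 1) = X (i + 1)) :
    ∃ Z, IsEar G S Z (k + l) ∧ earUnion S Z (k + l) = earUnion (earUnion S X k) Y l := by
  have hX : ∀ j ≤ k + 1, X j ∈ earUnion S X k := fun j hj => h.apply_mem_earUnion hj
  have hY : ∀ j, 1 ≤ j → j ≤ l → Y j ∉ earUnion S X k := h'.out
  have hYX : ∀ j j', 1 ≤ j → j ≤ l → j' ≤ k + 1 → Y j ≠ X j' := fun j j' h1 h2 h3 he =>
    hY j h1 h2 (he ▸ hX j' h3)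
  refine ⟨fun j => if j ≤ i then X j else if j ≤ i + l then Y (j - i) else X (j - l),
    ⟨by omega, ?_, ?_, ?_, ?_, ?_⟩, ?_⟩
  · intro j hj
    rcases lt_trichotomy j i with hji | rfl | hji
    · simp only [if_pos hji.le, if_pos (show j + 1 ≤ i by omega)]
      exact h.adj j (by omega)
    · simp only [if_pos le_rfl, if_neg (show ¬ j + 1 ≤ j by omega),
        if_pos (show j + 1 ≤ j + l by have := h'.pos; omega)]
      rw [← h0, show j + 1 - j = 0 + 1 by omega]
      exact h'.adj 0 (by omega)
    · simp only [if_neg (show ¬ j ≤ i by omega), if_neg (show ¬ j + 1 ≤ i by omega)]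
      rcases lt_trichotomy j (i + l) with hj' | rfl | hj'
      · simp only [if_pos hj'.le, if_pos (show j + 1 ≤ i + l by omega)]
        rw [show j + 1 - i = j - i + 1 by omega]
        exact h'.adj _ (by omega)
      · simp only [if_pos le_rfl, if_neg (show ¬ i + l + 1 ≤ i + l by omega)]
        rw [show i + l + 1 - l = i + 1 by omega, ← hl, show i + l - i = l by omega]
        exact h'.adj _ le_rfl
      · simp only [if_neg (show ¬ j ≤ i + l by omega), if_neg (show ¬ j + 1 ≤ i + l by omega)]
        rw [show j + 1 - l = j - l + 1 by omega]
        exact h.adj _ (by omega)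
  · intro a b hab hb
    split_ifs
    · exact h.inj _ _ hab (by omega)
    · exact (hYX _ _ (by omega) (by omega) (by omega)).symm
    · exact h.inj _ _ (by omega) (by omega)
    · omega
    · exact h'.inj _ _ (by omega) (by omega)
    · exact hYX _ _ (by omega) (by omega) (by omega)
    · omega
    · omega
    · exact h.inj _ _ (by omega) (by omega)
  · simpa using h.left
  · rw [if_neg (by omega), if_neg (by omega), show k + l + 1 - l = k + 1 by omega]
    exact h.right
  · intro j hj hj'
    split_ifs
    · exact h.out _ (by omega) (by omega)
    · exact fun hm => hY _ (by omega) (by omega) (mem_earUnion_of_mem hm)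
    · exact h.out _ (by omega) (by omega)
  · ext v
    simp only [mem_earUnion]
    constructor
    · rintro (hv | ⟨j, hj, hj', rfl⟩)
      · exact .inl (.inl hv)
      · split_ifs
        · exact .inl (.inr ⟨j, by omega, by omega, rfl⟩)
        · exact .inr ⟨j - i, by omega, by omega, rfl⟩
        · exact .inl (.inr ⟨j - l, by omega, by omega, rfl⟩)
    · rintro ((hv | ⟨j, hj, hj', rfl⟩) | ⟨j, hj, hj', rfl⟩)
      · exact .inl hv
      · by_cases hji : j ≤ i
        · exact .inr ⟨j, by omega, by omega, by rw [if_pos hji]⟩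
        · exact .inr ⟨j + l, by omega, by omega, by
            rw [if_neg (by omega), if_neg (by omega)]; congr 1; omega⟩
      · exact .inr ⟨i + j, by omega, by omega, by
          rw [if_neg (by omega), if_pos (by omega)]; congr 1; omega⟩

/-- Two ears that are both attached to `S` can be added in either order. -/
lemma swap (h : IsEar G S X k) (h' : IsEar G (earUnion S X k) Y l) (h0 : Y 0 ∈ S)
    (hl : Y (l + 1) ∈ S) : IsEar G S Y l ∧ IsEar G (earUnion S Y l) X k ∧
      earUnion (earUnion S Y l) X k = earUnion (earUnion S X k) Y l := by
  refine ⟨⟨h'.pos, h'.adj, h'.inj, h0, hl, fun i hi hi' hm =>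
    h'.out i hi hi' (mem_earUnion_of_mem hm)⟩, ⟨h.pos, h.adj, h.inj, mem_earUnion_of_mem h.left,
    mem_earUnion_of_mem h.right, fun i hi hi' hm => ?_⟩, ?_⟩
  · rcases mem_earUnion.1 hm with hm | ⟨j, hj, hj', he⟩
    · exact h.out i hi hi' hm
    · exact h'.out j hj hj' (he ▸ h.apply_mem_earUnion (by omega))
  · ext v
    simp only [mem_earUnion]
    exact or_right_comm

end IsEar

end

section

variable {V : Type*} {G : SimpleGraph V}
variable {S T E : Finset V} {X Y : ℕ → V} {k l n : ℕ} {t r u v w : V}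

/-! ### Vertex sets without cut vertex -/

/-- `S` has at least two vertices, and the graph induced on `S` is connected and remains connected
when one vertex is removed. (`W` is empty or a single vertex.) The two ends of an edge are such a
set; on at least three vertices this is 2-connectedness. -/
def NoCut (G : SimpleGraph V) (S : Finset V) : Prop :=
  2 ≤ S.card ∧ ∀ W : Set V, W.Subsingleton → ∀ u ∈ S, ∀ v ∈ S, u ∉ W → v ∉ W →
    ∃ p : G.Walk u v, ∀ x ∈ p.support, x ∈ S ∧ x ∉ W

open Classical in
lemma noCut_pair (h : G.Adj u v) : NoCut G {u, v} := by
  refine ⟨(Finset.card_pair h.ne).ge, ?_⟩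
  intro W _ a ha b hb haW hbW
  by_cases hab : a = b
  · subst hab
    exact ⟨.nil, by simpa using ⟨by simpa using ha, haW⟩⟩
  have hadj : G.Adj a b := by
    simp only [Finset.mem_insert, Finset.mem_singleton] at ha hb
    rcases ha with rfl | rfl <;> rcases hb with rfl | rfl
    exacts [absurd rfl hab, h, h.symm, absurd rfl hab]
  refine ⟨hadj.toWalk, fun x hx => ?_⟩
  have hx : x = a ∨ x = b := by simpa using hx
  rcases hx with rfl | rfl
  exacts [⟨ha, haW⟩, ⟨hb, hbW⟩]

lemma NoCut.adj_of_card_eq_two (h : NoCut G S) (hS : S.card = 2) :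
    ∀ u ∈ S, ∀ v ∈ S, u ≠ v → G.Adj u v := by
  classical
  intro u hu v hv huv
  obtain ⟨p, hp⟩ := h.2 ∅ subsingleton_empty u hu v hv (by simp) (by simp)
  have hS' : ({u, v} : Finset V) = S := by
    refine Finset.eq_of_subset_of_card_le ?_ (by rw [Finset.card_pair huv, hS])
    intro x hx
    simp only [Finset.mem_insert, Finset.mem_singleton] at hx
    rcases hx with rfl | rfl <;> assumption
  cases p with
  | nil => exact absurd rfl huv
  | cons hadj q =>
    rename_i x
    have hx : x ∈ ({u, v} : Finset V) := by
      rw [hS']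
      exact (hp x (by simp)).1
    simp only [Finset.mem_insert, Finset.mem_singleton] at hx
    rcases hx with rfl | rfl
    · exact absurd rfl hadj.ne
    · exact hadj

lemma IsEar.exists_walk (h : IsEar G S X k) {i j : ℕ} (hij : i ≤ j) (hj : j ≤ k + 1) :
    ∃ p : G.Walk (X i) (X j), ∀ x ∈ p.support, ∃ a, i ≤ a ∧ a ≤ j ∧ X a = x := by
  induction j, hij using Nat.le_induction with
  | base => exact ⟨.nil, fun x hx => ⟨i, le_rfl, le_rfl, by simpa using Eq.symm (by simpa using hx)⟩⟩
  | succ j hij ih =>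
    obtain ⟨p, hp⟩ := ih (by omega)
    refine ⟨p.concat (h.adj j (by omega)), fun x hx => ?_⟩
    rw [SimpleGraph.Walk.support_concat] at hx
    simp only [List.mem_append, List.mem_singleton] at hx
    rcases hx with hx | rfl
    · obtain ⟨a, h1, h2, h3⟩ := hp x hx
      exact ⟨a, h1, by omega, h3⟩
    · exact ⟨j + 1, by omega, le_rfl, rfl⟩

lemma IsEar.noCut (h : IsEar G S X k) (hS : NoCut G S) : NoCut G (earUnion S X k) := by
  refine ⟨hS.1.trans (Finset.card_le_card subset_earUnion), ?_⟩
  intro W hW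
  -- An inner vertex of the ear can walk to at least one of the two ends without meeting `W`.
  have key : ∀ u ∈ earUnion S X k, u ∉ W → ∃ s ∈ S, s ∉ W ∧
      ∃ p : G.Walk u s, ∀ x ∈ p.support, x ∈ earUnion S X k ∧ x ∉ W := by
    intro u hu huW
    rcases mem_earUnion.1 hu with hu' | ⟨i, hi, hi', rfl⟩
    · exact ⟨u, hu', huW, .nil, by simpa using ⟨hu, huW⟩⟩
    by_cases hleft : ∀ a ≤ i, X a ∉ W
    · obtain ⟨p, hp⟩ := h.exists_walk (Nat.zero_le i) (by omega)
      refine ⟨X 0, h.left, hleft 0 (by omega), p.reverse, fun x hx => ?_⟩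
      obtain ⟨a, -, ha, rfl⟩ := hp x (by simpa using hx)
      exact ⟨h.apply_mem_earUnion (by omega), hleft a ha⟩
    · push Not at hleft
      obtain ⟨b, hb, hbW⟩ := hleft
      have hbi : b ≠ i := by rintro rfl; exact huW hbW
      have hright : ∀ a, i ≤ a → a ≤ k + 1 → X a ∉ W := fun a ha ha' haW =>
        h.inj b a (by omega) ha' (hW hbW haW)
      obtain ⟨p, hp⟩ := h.exists_walk (show i ≤ k + 1 by omega) le_rfl
      refine ⟨X (k + 1), h.right, hright _ (by omega) le_rfl, p, fun x hx => ?_⟩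
      obtain ⟨a, ha, ha', rfl⟩ := hp x hx
      exact ⟨h.apply_mem_earUnion (by omega), hright a ha ha'⟩
  intro u hu v hv huW hvW
  obtain ⟨s, hs, hsW, p, hp⟩ := key u hu huW
  obtain ⟨s', hs', hsW', p', hp'⟩ := key v hv hvW
  obtain ⟨q, hq⟩ := hS.2 W hW s hs s' hs' hsW hsW'
  refine ⟨(p.append q).append p'.reverse, fun x hx => ?_⟩
  rw [SimpleGraph.Walk.mem_support_append_iff, SimpleGraph.Walk.mem_support_append_iff,
    SimpleGraph.Walk.support_reverse, List.mem_reverse] at hx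
  rcases hx with (hx | hx) | hx
  exacts [hp x hx, ⟨mem_earUnion_of_mem (hq x hx).1, (hq x hx).2⟩, hp' x hx]

/-- The part of a walk up to its first vertex in `T`, made into a path. -/
lemma exists_path_to_first_hit (p : G.Walk v w) (hv : v ∉ T) (hw : w ∈ T) :
    ∃ (n : ℕ) (Y : ℕ → V), 1 ≤ n ∧ Y 0 = v ∧ (∀ i < n, G.Adj (Y i) (Y (i + 1))) ∧
      (∀ i j, i < j → j ≤ n → Y i ≠ Y j) ∧ Y n ∈ T ∧ (∀ i < n, Y i ∉ T) ∧
      ∀ i, Y i ∈ p.support := by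
  classical
  have hq := p.bypass_isPath
  have hex : ∃ i, p.bypass.getVert i ∈ T := ⟨p.bypass.length, by simpa using hw⟩
  have hlen : Nat.find hex ≤ p.bypass.length := Nat.find_min' hex (by simpa using hw)
  refine ⟨Nat.find hex, p.bypass.getVert, ?_, by simp, ?_, ?_, Nat.find_spec hex, ?_, ?_⟩
  · by_contra h0
    have := Nat.find_spec hex
    rw [show Nat.find hex = 0 by omega] at this
    exact hv (by simpa using this)
  · exact fun i hi => p.bypass.adj_getVert_succ (by omega)
  · intro i j hij hj he
    have := hq.getVert_injOn (by simp only [mem_ofPred_eq]; omega)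
      (by simp only [mem_ofPred_eq]; omega) he
    omega
  · exact fun i hi => Nat.find_min hex hi
  · exact fun i => p.support_bypass_subset_support (p.bypass.getVert_mem_support i)

/-- In a set without cut vertex, every edge leaving a smaller set starts an ear. -/
lemma NoCut.exists_ear_of_adj (hS : NoCut G S) (hTS : T ⊆ S) (hT : 2 ≤ T.card) (hu : u ∈ T)
    (hv : v ∈ S) (hvT : v ∉ T) (huv : G.Adj u v) :
    ∃ X k, IsEar G T X k ∧ (∀ i ≤ k + 1, X i ∈ S) ∧ X 0 = u ∧ X 1 = v := by
  obtain ⟨w, hw, hwu⟩ := Finset.exists_mem_ne hT u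
  obtain ⟨p, hp⟩ := hS.2 {u} subsingleton_singleton v hv w (hTS hw)
    (by rintro rfl; exact hvT hu) hwu
  obtain ⟨n, Y, hn, h0, hadj, hinj, hend, hout, hsupp⟩ := exists_path_to_first_hit p hvT hw
  have hYu : ∀ i, Y i ≠ u := fun i => (hp _ (hsupp i)).2
  refine ⟨fun i => if i = 0 then u else Y (i - 1), n, ⟨hn, ?_, ?_, ?_, ?_, ?_⟩, ?_, by simp,
    by simpa using h0⟩
  · intro i hi
    rcases i with _ | i
    · simpa [h0] using huv
    · simpa using hadj i (by omega)
  · intro i j hij hj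
    rcases j with _ | j
    · omega
    rcases i with _ | i
    · simpa using (hYu j).symm
    · simpa using hinj i j (by omega) (by omega)
  · simpa using hu
  · simpa using hend
  · intro i hi hi'
    rw [if_neg (by omega)]
    exact hout _ (by omega)
  · intro i hi
    dsimp only
    split_ifs
    exacts [hTS hu, (hp _ (hsupp _)).1]

lemma NoCut.exists_ear (hS : NoCut G S) (hTS : T ⊆ S) (hne : T ≠ S) (hT : 2 ≤ T.card) :
    ∃ X k, IsEar G T X k ∧ ∀ i ≤ k + 1, X i ∈ S := by
  obtain ⟨a, ha⟩ := Finset.card_pos.1 (show 0 < T.card by omega)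
  obtain ⟨b, hb, hbT⟩ := Finset.exists_of_ssubset (hTS.ssubset_of_ne hne)
  obtain ⟨p, hp⟩ := hS.2 ∅ subsingleton_empty a (hTS ha) b hb (by simp) (by simp)
  obtain ⟨d, hd, hd1, hd2⟩ := p.exists_boundary_dart (T : Set V) ha hbT
  obtain ⟨X, k, h1, h2, -⟩ := hS.exists_ear_of_adj hTS hT hd1
    (hp _ (p.dart_snd_mem_support_of_mem_darts hd)).1 hd2 d.adj
  exact ⟨X, k, h1, h2⟩

/-! ### Cycles through two vertices -/

/-- `X 0, …, X n` are the vertices of a cycle of `G` inside `S`, in cyclic order. -/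
structure IsCycleIn (G : SimpleGraph V) (S : Finset V) (X : ℕ → V) (n : ℕ) : Prop where
  two_le : 2 ≤ n
  adj : ∀ i < n, G.Adj (X i) (X (i + 1))
  inj : ∀ i j, i < j → j ≤ n → X i ≠ X j
  close : G.Adj (X n) (X 0)
  mem : ∀ i ≤ n, X i ∈ S

/-- Replacing the arc from `X i` to `X j` of a cycle by an ear. -/
lemma IsCycleIn.reroute (hX : IsCycleIn G S X n) (hY : IsEar G T Y k)
    (hT : ∀ a ≤ n, X a ∈ T) (hYS : ∀ a ≤ k + 1, Y a ∈ S) {i j : ℕ} (hij : i < j) (hj : j ≤ n)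
    (h0 : Y 0 = X i) (hk : Y (k + 1) = X j) :
    ∃ Z m, IsCycleIn G S Z m ∧ Z 0 = X 0 ∧ ∀ a, 1 ≤ a → a ≤ k → ∃ b ≤ m, Z b = Y a := by
  have hYX : ∀ a b, 1 ≤ a → a ≤ k → b ≤ n → Y a ≠ X b := fun a b h1 h2 h3 he =>
    hY.out a h1 h2 (he ▸ hT b h3)
  have hpos := hY.pos
  refine ⟨fun a => if a ≤ i then X a else if a ≤ i + k then Y (a - i) else X (a - (i + k + 1) + j),
    i + k + (n - j + 1), ⟨by omega, ?_, ?_, ?_, ?_⟩, by simp, ?_⟩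
  · intro a ha
    rcases lt_trichotomy a i with hai | rfl | hai
    · simp only [if_pos hai.le, if_pos (show a + 1 ≤ i by omega)]
      exact hX.adj a (by omega)
    · simp only [if_pos le_rfl, if_neg (show ¬ a + 1 ≤ a by omega),
        if_pos (show a + 1 ≤ a + k by omega)]
      rw [← h0, show a + 1 - a = 0 + 1 by omega]
      exact hY.adj 0 (by omega)
    · simp only [if_neg (show ¬ a ≤ i by omega), if_neg (show ¬ a + 1 ≤ i by omega)]
      rcases lt_trichotomy a (i + k) with ha' | rfl | ha'
      · simp only [if_pos ha'.le, if_pos (show a + 1 ≤ i + k by omega)]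
        rw [show a + 1 - i = a - i + 1 by omega]
        exact hY.adj _ (by omega)
      · simp only [if_pos le_rfl, if_neg (show ¬ i + k + 1 ≤ i + k by omega)]
        rw [show i + k + 1 - (i + k + 1) + j = j by omega, ← hk, show i + k - i = k by omega]
        exact hY.adj _ le_rfl
      · simp only [if_neg (show ¬ a ≤ i + k by omega), if_neg (show ¬ a + 1 ≤ i + k by omega)]
        rw [show a + 1 - (i + k + 1) + j = a - (i + k + 1) + j + 1 by omega]
        exact hX.adj _ (by omega)
  · intro a b hab hb
    split_ifs
    · exact hX.inj _ _ hab (by omega)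
    · exact (hYX _ _ (by omega) (by omega) (by omega)).symm
    · exact hX.inj _ _ (by omega) (by omega)
    · omega
    · exact hY.inj _ _ (by omega) (by omega)
    · exact hYX _ _ (by omega) (by omega) (by omega)
    · omega
    · omega
    · exact hX.inj _ _ (by omega) (by omega)
  · simp only [if_neg (show ¬ i + k + (n - j + 1) ≤ i by omega),
      if_neg (show ¬ i + k + (n - j + 1) ≤ i + k by omega), if_pos (Nat.zero_le i)]
    rw [show i + k + (n - j + 1) - (i + k + 1) + j = n by omega]
    exact hX.close
  · intro a ha
    split_ifs
    · exact hX.mem _ (by omega)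
    · exact hYS _ (by omega)
    · exact hX.mem _ (by omega)
  · intro a ha ha'
    refine ⟨i + a, by omega, ?_⟩
    dsimp only
    rw [if_neg (by omega), if_pos (by omega), Nat.add_sub_cancel_left]

/-- Any two vertices of a 2-connected set lie on a common cycle. -/
lemma NoCut.exists_cycle (hS : NoCut G S) (hcard : 3 ≤ S.card) (ht : t ∈ S) (hr : r ∈ S) :
    ∃ X n, IsCycleIn G S X n ∧ X 0 = t ∧ ∃ i ≤ n, X i = r := by
  classical
  -- Some cycle passes through `t`.
  have hbase : ∃ X n, IsCycleIn G S X n ∧ X 0 = t := by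
    obtain ⟨w, hw, hwt⟩ := Finset.exists_mem_ne (show 1 < S.card by omega) t
    obtain ⟨p, hp⟩ := hS.2 ∅ subsingleton_empty t ht w hw (by simp) (by simp)
    obtain ⟨x, hx, htx⟩ : ∃ x ∈ S, G.Adj t x := by
      cases p with
      | nil => exact absurd rfl hwt
      | cons hadj q => exact ⟨_, (hp _ (by simp)).1, hadj⟩
    obtain ⟨X, k, hX, hXS⟩ := hS.exists_ear (T := {t, x})
      (by intro y hy; simp only [Finset.mem_insert, Finset.mem_singleton] at hy
          rcases hy with rfl | rfl <;> assumption)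
      (by intro he; rw [← he, Finset.card_pair htx.ne] at hcard; omega)
      (Finset.card_pair htx.ne).ge
    wlog hX0 : X 0 = t generalizing X
    · refine this (fun i => X (k + 1 - i)) hX.reverse (fun i hi => hXS _ (by omega)) ?_
      have h0 := hX.left
      have h1 := hX.right
      have h2 := hX.ends_ne
      simp only [Finset.mem_insert, Finset.mem_singleton] at h0 h1
      simp only [Nat.sub_zero]
      rcases h1 with h1 | h1
      · exact h1
      · rcases h0 with h0 | h0
        · exact absurd h0 hX0
        · exact absurd (h0.trans h1.symm) h2
    have hXk : X (k + 1) = x := by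
      have h1 := hX.right
      simp only [Finset.mem_insert, Finset.mem_singleton] at h1
      exact h1.resolve_left fun h => hX.ends_ne (hX0.trans h.symm)
    have hpos := hX.pos
    refine ⟨X, k + 1, ⟨by omega, fun i hi => hX.adj i (by omega), hX.inj, ?_, hXS⟩, hX0⟩
    rw [hXk, hX0]
    exact htx.symm
  obtain ⟨X₀, n₀, hX₀, h0⟩ := hbase
  obtain ⟨p, hp⟩ := hS.2 ∅ subsingleton_empty t ht r hr (by simp) (by simp)
  have hstart : ∃ X n, IsCycleIn G S X n ∧ X 0 = t ∧ ∃ i ≤ n, X i = t :=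
    ⟨X₀, n₀, hX₀, h0, 0, by omega, h0⟩
  -- The property of lying on a cycle with `t` passes from a vertex to its neighbours.
  have hstep : ∀ {w w' : V}, G.Adj w w' → w' ∈ S →
      (∃ X n, IsCycleIn G S X n ∧ X 0 = t ∧ ∃ i ≤ n, X i = w) →
      ∃ X n, IsCycleIn G S X n ∧ X 0 = t ∧ ∃ i ≤ n, X i = w' := by
    rintro w w' hadj hw' ⟨X, n, hX, hX0, i, hi, rfl⟩
    by_cases hw : ∃ i ≤ n, X i = w'
    · exact ⟨X, n, hX, hX0, hw⟩
    set T : Finset V := (Finset.range (n + 1)).image X with hTdef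
    have hT : ∀ a ≤ n, X a ∈ T := fun a ha =>
      Finset.mem_image_of_mem _ (Finset.mem_range.2 (by omega))
    have hTS : T ⊆ S := by
      intro y hy
      obtain ⟨a, ha, rfl⟩ := Finset.mem_image.1 hy
      exact hX.mem a (by simpa [Nat.lt_succ_iff] using ha)
    have hTmem : ∀ y ∈ T, ∃ a ≤ n, X a = y := by
      intro y hy
      obtain ⟨a, ha, rfl⟩ := Finset.mem_image.1 hy
      exact ⟨a, by simpa [Nat.lt_succ_iff] using ha, rfl⟩
    have h2 := hX.two_le
    have hTcard : 2 ≤ T.card :=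
      Finset.one_lt_card.2 ⟨_, hT 0 (by omega), _, hT 1 (by omega), hX.inj 0 1 (by omega) (by omega)⟩
    obtain ⟨Y, k, hY, hYS, hY0, hY1⟩ := hS.exists_ear_of_adj hTS hTcard (hT i hi) hw'
      (fun h => hw (hTmem _ h)) hadj
    obtain ⟨j, hj, hYk⟩ := hTmem _ hY.right
    have hpos := hY.pos
    rcases lt_trichotomy i j with hij | rfl | hij
    · obtain ⟨Z, m, hZ, hZ0, hZY⟩ := hX.reroute hY hT hYS hij hj hY0 hYk.symm
      obtain ⟨b, hb, hZb⟩ := hZY 1 le_rfl hpos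
      exact ⟨Z, m, hZ, hZ0.trans hX0, b, hb, hZb.trans hY1⟩
    · exact absurd (hY0.trans hYk) hY.ends_ne
    · obtain ⟨Z, m, hZ, hZ0, hZY⟩ := hX.reroute hY.reverse hT (fun a ha => hYS _ (by omega)) hij hi
        (by simpa using hYk.symm) (by simpa using hY0)
      obtain ⟨b, hb, hZb⟩ := hZY k hpos le_rfl
      refine ⟨Z, m, hZ, hZ0.trans hX0, b, hb, hZb.trans ?_⟩
      rw [show k + 1 - k = 1 by omega, hY1]
  clear hr
  revert hstart
  generalize hP : (fun w => ∃ X n, IsCycleIn G S X n ∧ X 0 = t ∧ ∃ i ≤ n, X i = w) = P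
  have hP' : ∀ w, P w ↔ ∃ X n, IsCycleIn G S X n ∧ X 0 = t ∧ ∃ i ≤ n, X i = w := by
    intro w; rw [← hP]
  rw [← hP', ← hP']
  replace hstep : ∀ {w w' : V}, G.Adj w w' → w' ∈ S → P w → P w' := by
    intro w w'; rw [hP', hP']; exact hstep
  clear hP hP' hX₀ h0 ht
  induction p with
  | nil => exact id
  | cons hadj q ih =>
    intro h
    exact ih (fun x hx => hp x (by simp [hx])) (hstep hadj (hp _ (by simp)).1 h)

/-- A 2-connected set `S` containing `t` and `r` arises by an ear from a smaller set without cut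
vertex that contains `t` and `r`, or from an edge at `t` (when `S` is spanned by a cycle). -/
lemma NoCut.exists_decomposition (hS : NoCut G S) (hcard : 3 ≤ S.card) (ht : t ∈ S) (hr : r ∈ S) :
    ∃ E X k, NoCut G E ∧ t ∈ E ∧ (r ∈ E ∨ E.card = 2) ∧ IsEar G E X k ∧ earUnion E X k = S := by
  classical
  obtain ⟨X, n, hX, rfl, i, hi, rfl⟩ := hS.exists_cycle hcard ht hr
  have h2 := hX.two_le
  have hn : n - 1 + 1 = n := by omega
  have hpair : NoCut G {X 0, X n} := noCut_pair hX.close.symm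
  have hear : IsEar G {X 0, X n} X (n - 1) := by
    refine ⟨by omega, fun i hi => hX.adj i (by omega), fun i j hij hj => hX.inj i j hij (by omega),
      by simp, by simp [hn], fun i hi hi' hm => ?_⟩
    simp only [Finset.mem_insert, Finset.mem_singleton] at hm
    rcases hm with hm | hm
    · exact hX.inj 0 i (by omega) (by omega) hm.symm
    · exact hX.inj i n (by omega) le_rfl hm
  have hsub : earUnion {X 0, X n} X (n - 1) ⊆ S := by
    intro v hv
    rcases mem_earUnion.1 hv with hv | ⟨i, hi, hi', rfl⟩
    · simp only [Finset.mem_insert, Finset.mem_singleton] at hv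
      rcases hv with rfl | rfl
      exacts [hX.mem _ (by omega), hX.mem _ le_rfl]
    · exact hX.mem _ (by omega)
  by_cases hC : earUnion {X 0, X n} X (n - 1) = S
  · exact ⟨_, X, n - 1, hpair, by simp, .inr (Finset.card_pair hX.close.symm.ne), hear, hC⟩
  -- Otherwise take a maximal proper subset without cut vertex containing the cycle's two vertices.
  set F := S.powerset.filter fun E => NoCut G E ∧ X 0 ∈ E ∧ X i ∈ E ∧ E ≠ S with hF
  have hne : F.Nonempty := by
    refine ⟨earUnion {X 0, X n} X (n - 1), Finset.mem_filter.2 ⟨Finset.mem_powerset.2 hsub,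
      hear.noCut hpair, hear.apply_mem_earUnion (by omega), hear.apply_mem_earUnion (by omega), hC⟩⟩
  obtain ⟨E, hE, hmax⟩ := F.exists_max_image Finset.card hne
  obtain ⟨hES, hE1, hE2, hE3, hE4⟩ := Finset.mem_filter.1 hE
  rw [Finset.mem_powerset] at hES
  obtain ⟨Y, k, hY, hYS⟩ := hS.exists_ear hES hE4 hE1.1
  refine ⟨E, Y, k, hE1, hE2, .inl hE3, hY, ?_⟩
  by_contra hneS
  have := hmax (earUnion E Y k) (Finset.mem_filter.2 ⟨Finset.mem_powerset.2 ?_, hY.noCut hE1,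
    mem_earUnion_of_mem hE2, mem_earUnion_of_mem hE3, hneS⟩)
  · rw [hY.card_earUnion] at this
    have := hY.pos
    omega
  · intro v hv
    rcases mem_earUnion.1 hv with hv | ⟨i, hi, hi', rfl⟩
    exacts [hES hv, hYS _ (by omega)]

end

section

variable {V : Type*} {G : SimpleGraph V}
variable {S E : Finset V} {X Y : ℕ → V} {k l : ℕ} {t r : V}

/-! ### The colouring of 2-connected sets -/

/-- `IsEar.splice` for an ear given in either direction. -/
lemma IsEar.splice_of_ends (h : IsEar G S X k) (h' : IsEar G (earUnion S X k) Y l) {i : ℕ}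
    (hi : 1 ≤ i) (hik : i + 1 ≤ k) (h0 : Y 0 = X i ∨ Y 0 = X (i + 1))
    (hl : Y (l + 1) = X i ∨ Y (l + 1) = X (i + 1)) :
    ∃ Z, IsEar G S Z (k + l) ∧ earUnion S Z (k + l) = earUnion (earUnion S X k) Y l := by
  have hne := h'.ends_ne
  rcases h0 with h0 | h0 <;> rcases hl with hl | hl
  · exact absurd (h0.trans hl.symm) hne
  · exact h.splice h' hi hik h0 hl
  · obtain ⟨Z, h1, h2⟩ := h.splice h'.reverse hi hik (by simpa using hl) (by simpa using h0)
    exact ⟨Z, h1, by rw [h2, IsEar.earUnion_reverse]⟩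
  · exact absurd (h0.trans hl.symm) hne

/-- `IsEar.oddGood_of_odd` with the slack available at either end of the ear. -/
lemma IsEar.oddGood_of_slack {m : ℕ} {U : Set V} (h : IsEar G S X k) (hk : k = 2 * m + 1)
    (hS : EvenSlack G S t U) (hU : X 0 ∈ U ∨ X (k + 1) ∈ U) (ht : t ∈ S)
    (hr : r ∈ S ∨ (S.card = 2 ∧ r ∈ earUnion S X k)) : OddGood G (earUnion S X k) t r := by
  rcases hU with hU | hU
  · exact h.oddGood_of_odd hk (hS.mono fun u hu => by rwa [mem_singleton_iff.1 hu]) ht hr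
  · rw [← earUnion_reverse] at hr ⊢
    exact h.reverse.oddGood_of_odd hk (hS.mono fun u hu => by
      rw [mem_singleton_iff.1 hu]; simpa using hU) ht hr

/-- The case of an ear with an odd number of inner vertices on a set `E` of even order. It fails
directly only when `t` has no slack to either end of the ear; decomposing `E` once more shows that
the last two ears can then be rearranged. -/
lemma oddGood_of_even_base {N : ℕ}
    (hodd : ∀ S' : Finset V, S'.card < N → NoCut G S' → Odd S'.card →
      ∀ t ∈ S', ∀ r ∈ S', OddGood G S' t r)
    (heven : ∀ S' : Finset V, S'.card < N → NoCut G S' → Even S'.card →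
      ∀ t ∈ S', EvenSlack G S' t ∅)
    (hN : S.card = N) (ht : t ∈ E) (hr : r ∈ S) (hE : NoCut G E) (hrE : r ∈ E ∨ E.card = 2)
    (hX : IsEar G E X k) (hk : Odd k) (hEven : Even E.card) (hS : earUnion E X k = S) :
    OddGood G S t r := by
  induction hn : E.card using Nat.strong_induction_on generalizing E X k with
  | _ n ih =>
  obtain ⟨m, hm⟩ := hk
  have hcardS := hX.card_earUnion
  rw [hS] at hcardS
  have hpos := hX.pos
  subst hS
  by_cases hE2 : E.card = 2
  · refine hX.oddGood_of_slack hm (evenSlack_pair hE2 (hE.adj_of_card_eq_two hE2) ht) ?_ ht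
      (.inr ⟨hE2, hr⟩)
    classical
    by_contra hcon
    push Not at hcon
    have h3 : ({X 0, X (k + 1), t} : Finset V).card = 3 :=
      Finset.card_eq_three.2 ⟨_, _, _, hX.ends_ne, hcon.1, hcon.2, rfl⟩
    have : ({X 0, X (k + 1), t} : Finset V).card ≤ E.card := by
      refine Finset.card_le_card fun v hv => ?_
      simp only [Finset.mem_insert, Finset.mem_singleton] at hv
      rcases hv with rfl | rfl | rfl
      exacts [hX.left, hX.right, ht]
    omega
  have hrE := hrE.resolve_right hE2
  have hcardE : 3 ≤ E.card := by have := hE.1; omega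
  obtain ⟨H, Y, l, hH, htH, hrH, hY, rfl⟩ := hE.exists_decomposition hcardE ht hrE
  have hcardH := hY.card_earUnion
  have hl := hY.pos
  have hH2 := hH.1
  rcases Nat.even_or_odd l with hle | hlo
  · obtain ⟨m', hm'⟩ := hle.exists_two_nsmul
    simp only [smul_eq_mul] at hm'
    have hHeven : Even H.card := by
      rw [hcardH, Nat.even_add] at hEven
      exact hEven.2 hle
    have hsl := hY.evenSlack_of_even hm' (heven H (by omega) hH hHeven t htH) htH
    by_cases h0 : X 0 ≠ Y m' ∧ X 0 ≠ Y (m' + 1)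
    · exact hX.oddGood_of_slack hm hsl (.inl ⟨hX.left, h0⟩) ht (.inl hrE)
    by_cases h1 : X (k + 1) ≠ Y m' ∧ X (k + 1) ≠ Y (m' + 1)
    · exact hX.oddGood_of_slack hm hsl (.inr ⟨hX.right, h1⟩) ht (.inl hrE)
    obtain ⟨Z, hZ, hZu⟩ := hY.splice_of_ends hX (i := m') (by omega) (by omega)
      (by tauto) (by tauto)
    exact ih H.card (by omega) htH hH hrH hZ (hle.add_odd ⟨m, hm⟩) hHeven hZu rfl
  have hHodd : Odd H.card := by
    rw [hcardH, Nat.even_add] at hEven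
    by_contra hcon
    rw [Nat.not_odd_iff_even, hEven] at hcon
    exact (Nat.not_even_iff_odd.2 hlo) hcon
  have hrH : r ∈ H := hrH.resolve_right fun h => by
    rw [h] at hHodd
    exact absurd hHodd (by decide)
  obtain ⟨m', hm'⟩ := hlo
  rcases Nat.eq_zero_or_pos m' with rfl | hm'pos
  · obtain rfl : l = 1 := by omega
    -- The previous ear has a single inner vertex.
    have hmerge : ∀ Z : ℕ → V, IsEar G H Z (k + 1) →
        earUnion H Z (k + 1) = earUnion (earUnion H Y 1) X k →
        OddGood G (earUnion (earUnion H Y 1) X k) t r := fun Z hZ hZu => by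
      rw [← hZu]
      exact hZ.oddGood_of_even (m := m + 1) (by omega) (hodd H (by omega) hH hHodd t htH r hrH) hrH
    have hmem : ∀ v ∈ earUnion H Y 1, v ∉ H → v = Y 1 := by
      intro v hv hvH
      rcases mem_earUnion.1 hv with hv | ⟨i, hi, hi', rfl⟩
      · exact absurd hv hvH
      · rw [show i = 1 by omega]
    by_cases h0 : X 0 ∈ H
    swap
    · have h0' := hmem _ hX.left h0
      have h1 : X (k + 1) ∈ H := by
        by_contra h1
        exact hX.ends_ne (h0'.trans (hmem _ hX.right h1).symm)
      obtain ⟨Z, hZ, hZu⟩ := hY.merge hX h0' h1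
      exact hmerge Z hZ hZu
    by_cases h1 : X (k + 1) ∈ H
    swap
    · obtain ⟨Z, hZ, hZu⟩ := hY.merge hX.reverse (by simpa using hmem _ hX.right h1) (by simpa)
      exact hmerge Z hZ (hZu.trans IsEar.earUnion_reverse)
    rcases Nat.eq_zero_or_pos m with rfl | hmpos
    · obtain rfl : k = 1 := by omega
      exact hY.oddGood_of_two hX (hodd H (by omega) hH hHodd _ hY.left t htH) h0 h1 htH hrH
    · obtain ⟨hX', hY', hu⟩ := hY.swap hX h0 h1
      rw [← hu]
      have hsl := hX'.evenSlack_of_odd hm (hodd H (by omega) hH hHodd _ h0 _ h0) htH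
      refine hY'.oddGood_of_slack (m := 0) rfl hsl (.inl ⟨hmpos, hY'.left, ?_, ?_⟩)
        (mem_earUnion_of_mem htH) (.inl (mem_earUnion_of_mem hrH))
      · intro he
        exact hX'.out (m + 1) (by omega) (by omega) (he ▸ hY.left)
      · intro he
        exact hX'.out (m + 2) (by omega) (by omega) (he ▸ hY.left)
  · have hsl := hY.evenSlack_of_odd hm' (hodd H (by omega) hH hHodd _ hY.left _ hY.left) htH
    by_cases h0 : X 0 ≠ Y (m' + 1) ∧ X 0 ≠ Y (m' + 2)
    · exact hX.oddGood_of_slack hm hsl (.inl ⟨hm'pos, hX.left, h0⟩) ht (.inl hrE)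
    by_cases h1 : X (k + 1) ≠ Y (m' + 1) ∧ X (k + 1) ≠ Y (m' + 2)
    · exact hX.oddGood_of_slack hm hsl (.inr ⟨hm'pos, hX.right, h1⟩) ht (.inl hrE)
    obtain ⟨Z, hZ, hZu⟩ := hY.splice_of_ends hX (i := m' + 1) (by omega) (by omega)
      (by tauto) (by tauto)
    rw [← hZu]
    exact hZ.oddGood_of_even (m := m + m' + 1) (by omega)
      (hodd H (by omega) hH hHodd t htH r hrH) hrH

/-- Every set without cut vertex has the colourings required by the two invariants. -/
theorem NoCut.exists_coloring (hS : NoCut G S) :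
    (Odd S.card → ∀ t ∈ S, ∀ r ∈ S, OddGood G S t r) ∧
      (Even S.card → ∀ t ∈ S, EvenSlack G S t ∅) := by
  induction hn : S.card using Nat.strong_induction_on generalizing S with
  | _ n ih =>
  have hodd : ∀ S' : Finset V, S'.card < n → NoCut G S' → Odd S'.card →
      ∀ t ∈ S', ∀ r ∈ S', OddGood G S' t r := fun S' h1 h2 h3 =>
    (ih _ h1 h2 rfl).1 h3
  have heven : ∀ S' : Finset V, S'.card < n → NoCut G S' → Even S'.card →
      ∀ t ∈ S', EvenSlack G S' t ∅ := fun S' h1 h2 h3 =>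
    (ih _ h1 h2 rfl).2 h3
  have h2 := hS.1
  constructor
  · intro hno t ht r hr
    have h3 : 3 ≤ S.card := by
      obtain ⟨a, ha⟩ := hno
      omega
    obtain ⟨E, X, k, hE, htE, hrE, hX, hSE⟩ := hS.exists_decomposition h3 ht hr
    have hcard := hX.card_earUnion
    rw [hSE, hn] at hcard
    have hpos := hX.pos
    rcases Nat.even_or_odd k with hk | hk
    · have hEodd : Odd E.card := by
        rw [hcard, Nat.odd_add] at hno
        exact hno.2 hk
      have hrE : r ∈ E := hrE.resolve_right fun h => by
        rw [h] at hEodd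
        exact absurd hEodd (by decide)
      obtain ⟨m, hm⟩ := hk
      rw [← hSE]
      exact hX.oddGood_of_even (m := m) (by omega) (hodd E (by omega) hE hEodd t htE r hrE) hrE
    · refine oddGood_of_even_base hodd heven hn htE hr hE hrE hX hk ?_ hSE
      rw [hcard, Nat.odd_add'] at hno
      exact hno.1 hk
  · intro hne t ht
    by_cases hcard2 : S.card = 2
    · exact (evenSlack_pair hcard2 (hS.adj_of_card_eq_two hcard2) ht).mono (by simp)
    obtain ⟨E, X, k, hE, htE, -, hX, hSE⟩ := hS.exists_decomposition (by omega) ht ht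
    have hcard := hX.card_earUnion
    rw [hSE, hn] at hcard
    have hpos := hX.pos
    rw [← hSE]
    rw [hcard, Nat.even_add] at hne
    rcases Nat.even_or_odd k with hk | hk
    · have hE' := heven E (by omega) hE (hne.2 hk) t htE
      obtain ⟨m, hm⟩ := hk
      exact (hX.evenSlack_of_even (m := m) (by omega) hE' htE).mono (by simp)
    · have hEodd : Odd E.card := by
        rw [← Nat.not_even_iff_odd, hne, Nat.not_even_iff_odd]
        exact hk
      obtain ⟨m, hm⟩ := hk
      exact (hX.evenSlack_of_odd hm (hodd E (by omega) hE hEodd _ hX.left _ hX.left) htE).mono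
        (by simp)

end

/-! ### The upper bound -/

lemma ceil_half (n : ℕ) : ⌈(n : ℚ) / 2⌉₊ = (n + 1) / 2 := by
  refine le_antisymm (Nat.ceil_le.2 ?_) (Nat.le_of_lt_succ ?_)
  · rw [div_le_iff₀ (by norm_num)]
    exact_mod_cast (by omega : n ≤ (n + 1) / 2 * 2)
  · have h := Nat.le_ceil ((n : ℚ) / 2)
    rw [div_le_iff₀ (by norm_num)] at h
    have h : n ≤ ⌈(n : ℚ) / 2⌉₊ * 2 := by exact_mod_cast h
    omega

lemma TwoConnected.noCut_univ {V : Type*} [Fintype V] {G : SimpleGraph V} (h : TwoConnected G) :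
    NoCut G Finset.univ := by
  refine ⟨by have := h.three_le_card; rw [Finset.card_univ]; omega, ?_⟩
  intro W hW u _ v _ hu hv
  rcases hW.eq_empty_or_singleton with rfl | ⟨w, rfl⟩
  · obtain ⟨p⟩ := h.connected.preconnected u v
    exact ⟨p, by simp⟩
  · obtain ⟨p⟩ := (h.connected_delete w).preconnected ⟨u, hu⟩ ⟨v, hv⟩
    refine ⟨p.map (SimpleGraph.Embedding.induce _).toHom, fun x hx => ⟨Finset.mem_univ _, ?_⟩⟩
    have hs := p.support_map (SimpleGraph.Embedding.induce _).toHom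
    obtain ⟨y, -, rfl⟩ := List.mem_map.1 ((congrArg (x ∈ ·) hs).mp hx)
    exact y.2

lemma rc_le_of_rainbowOn {V : Type*} {G : SimpleGraph V} {c : Sym2 V → ℕ}
    {S : Set V} {K : ℕ} (hS : ∀ v, v ∈ S) (hK : 0 < K) (h : RainbowOn G c S K) : rc G ≤ K := by
  classical
  refine iInf₂_le K ⟨fun e => if he : c e.1 < K then ⟨c e.1, he⟩ else ⟨0, hK⟩, ?_⟩
  intro u v
  obtain ⟨p, -, hp, hpK⟩ := h u (hS u) v (hS v)
  refine ⟨p.bypass, p.bypass_isPath, fun e f he hf hef => Subtype.ext ?_⟩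
  have he := p.edges_bypass_subset_edges he
  have hf := p.edges_bypass_subset_edges hf
  refine List.inj_on_of_nodup_map hp he hf ?_
  simp only [dif_pos (mem_Iio.1 (hpK _ he)), dif_pos (mem_Iio.1 (hpK _ hf))] at hef
  exact congrArg Fin.val hef

lemma TwoConnected.rc_le {V : Type*} [Fintype V] {G : SimpleGraph V} (h : TwoConnected G) :
    rc G ≤ ((⌈(Fintype.card V : ℚ) / 2⌉₊ : ℕ) : ℕ∞) := by
  have h3 := h.three_le_card
  obtain ⟨t⟩ := h.connected.nonempty
  have hcol := h.noCut_univ.exists_coloring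
  rw [Finset.card_univ] at hcol
  rw [ceil_half]
  rcases Nat.even_or_odd (Fintype.card V) with hpar | hpar
  · obtain ⟨K, c, hK, hc, -⟩ := hcol.2 hpar t (Finset.mem_univ _)
    rw [Finset.card_univ] at hK
    rw [show (Fintype.card V + 1) / 2 = K by omega]
    exact rc_le_of_rainbowOn (by simp) (by omega) hc
  · obtain ⟨K, c, hK, hc, -⟩ := hcol.1 hpar t (Finset.mem_univ _) t (Finset.mem_univ _)
    rw [Finset.card_univ] at hK
    rw [show (Fintype.card V + 1) / 2 = K by omega]
    exact rc_le_of_rainbowOn (by simp) (by omega) hc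

/-! ### Cycles -/

section Cycle

open SimpleGraph

variable {n : ℕ}

/-- The vertex `i mod n` of the cycle `C_n`. -/
def cycleVert (hn : 0 < n) (i : ℕ) : Fin n := ⟨i % n, Nat.mod_lt i hn⟩

lemma cycleVert_val (hn : 0 < n) (u : Fin n) : cycleVert hn u = u :=
  Fin.ext (Nat.mod_eq_of_lt u.2)

lemma cycleVert_eq_iff (hn : 0 < n) {i j : ℕ} : cycleVert hn i = cycleVert hn j ↔ i ≡ j [MOD n] :=
  Fin.ext_iff

lemma cycleVert_ne (hn : 0 < n) {i j : ℕ} (hij : i < j) (hj : j < i + n) :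
    cycleVert hn i ≠ cycleVert hn j := by
  rw [Ne, cycleVert_eq_iff]
  intro h
  have := Nat.le_of_dvd (by omega) ((Nat.modEq_iff_dvd' hij.le).1 h)
  omega

lemma eq_cycleVert_succ (hn : 2 ≤ n) {u v : Fin n} (h : (v - u).val = 1) :
    v = cycleVert (by omega) (u + 1) := by
  rw [← cycleVert_val (by omega) v, cycleVert_eq_iff]
  rw [Fin.sub_def] at h
  have h' : n - u.val + v.val ≡ 1 [MOD n] := by
    rw [Nat.ModEq, Nat.mod_eq_of_lt (show 1 < n by omega)]
    exact h
  have := h'.add_right u.val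
  rw [show n - u.val + v.val + u.val = v.val + n by omega] at this
  simpa [Nat.ModEq, add_comm] using this

lemma cycleGraph_adj_cycleVert (hn : 2 ≤ n) (i : ℕ) :
    (cycleGraph n).Adj (cycleVert (by omega) i) (cycleVert (by omega) (i + 1)) := by
  obtain ⟨n, rfl⟩ := Nat.exists_eq_add_of_le' hn
  rw [cycleGraph_adj]
  right
  rw [sub_eq_iff_eq_add]
  apply Fin.ext
  simp only [cycleVert, Fin.val_add, Fin.val_one]
  rw [Nat.add_mod_mod, add_comm]

lemma cycleGraph_twoConnected (hn : 3 ≤ n) : TwoConnected (cycleGraph n) := by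
  have hn0 : 0 < n := by omega
  refine ⟨by simpa, ?_, fun v => ?_⟩
  · obtain ⟨n, rfl⟩ := Nat.exists_eq_add_of_le' hn0
    exact cycleGraph_connected
  have hmem : ∀ j, 1 ≤ j → j < n → cycleVert hn0 (v + j) ∈ ({v}ᶜ : Set (Fin n)) := by
    intro j hj hjn h
    have h : cycleVert hn0 (v + j) = v := h
    rw [← cycleVert_val hn0 v] at h
    refine cycleVert_ne hn0 (i := v) (j := v + j) (by omega) (by omega) ?_
    rw [← h]
    simp [cycleVert]
  have hreach : ∀ j (hj : 1 ≤ j) (hjn : j < n), ((cycleGraph n).induce {v}ᶜ).Reachable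
      ⟨_, hmem 1 le_rfl (by omega)⟩ ⟨_, hmem j hj hjn⟩ := by
    intro j hj
    induction j, hj using Nat.le_induction with
    | base => exact fun _ => .refl _
    | succ j hj ih =>
      intro hjn
      refine (ih (by omega)).trans (SimpleGraph.Adj.reachable ?_)
      exact cycleGraph_adj_cycleVert (by omega) (v + j)
  have hall : ∀ u : ({v}ᶜ : Set (Fin n)), ((cycleGraph n).induce {v}ᶜ).Reachable
      ⟨_, hmem 1 le_rfl (by omega)⟩ u := by
    rintro ⟨u, hu⟩
    have hu' : u.val ≠ v.val := fun h => hu (Fin.ext h)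
    have hu2 := u.2
    have hv2 := v.2
    by_cases huv : v.val < u.val
    · have := hreach (u - v) (by omega) (by omega)
      have he : cycleVert hn0 (v + (u - v)) = u := by
        rw [show v.val + (u.val - v.val) = u.val by omega, cycleVert_val]
      simpa only [he] using this
    · have := hreach (u + n - v) (by omega) (by omega)
      have he : cycleVert hn0 (v + (u + n - v)) = u := by
        rw [show v.val + (u.val + n - v.val) = u.val + n by omega]
        apply Fin.ext
        simp [cycleVert, Nat.mod_eq_of_lt hu2]
      simpa only [he] using this
  exact (SimpleGraph.connected_iff _).2 ⟨fun a b => (hall a).symm.trans (hall b), ⟨_, hmem 1 le_rfl (by omega)⟩⟩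

/-- A walk in the cycle lifts to the integers: `d` is its signed displacement. If the displacement
equals the length, the walk runs in the positive direction throughout. -/
lemma exists_displacement (hn : 2 ≤ n) {u v : Fin n} (p : (cycleGraph n).Walk u v) :
    ∃ d : ℤ, |d| ≤ p.length ∧ (u : ℤ) + d ≡ v [ZMOD n] ∧
      (d = p.length → ∀ i < p.length,
        s(cycleVert (by omega : 0 < n) (u + i), cycleVert (by omega) (u + i + 1)) ∈ p.edges) := by
  induction p with
  | nil => exact ⟨0, by simp, by simp, by simp⟩
  | @cons u w v hadj p ih =>
    obtain ⟨d, h1, h2, h3⟩ := ih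
    rw [abs_le] at h1
    rw [cycleGraph_adj'] at hadj
    simp only [Walk.length_cons, Walk.edges_cons, Nat.cast_add, Nat.cast_one]
    rcases hadj with hadj' | hadj'
    · have hu := eq_cycleVert_succ hn hadj'
      have hmod : (u : ℤ) ≡ w + 1 [ZMOD n] := by
        have : u.val ≡ w.val + 1 [MOD n] := by
          conv_lhs => rw [hu]
          exact Nat.mod_modEq _ _
        exact_mod_cast (Int.natCast_modEq_iff.2 this)
      refine ⟨d - 1, by rw [abs_le]; omega, ?_, fun h => by omega⟩
      have := (hmod.add_right (d - 1))
      rw [show (w : ℤ) + 1 + (d - 1) = w + d by ring] at this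
      exact this.trans h2
    · have hw := eq_cycleVert_succ hn hadj'
      have hmod' : w.val ≡ u.val + 1 [MOD n] := by
        conv_lhs => rw [hw]
        exact Nat.mod_modEq _ _
      have hmod : (w : ℤ) ≡ u + 1 [ZMOD n] := by
        exact_mod_cast (Int.natCast_modEq_iff.2 hmod')
      refine ⟨d + 1, by rw [abs_le]; omega, ?_, fun h i hi => ?_⟩
      · have := (hmod.symm.add_right d)
        rw [show (u : ℤ) + 1 + d = u + (d + 1) by ring] at this
        exact this.trans h2
      · rcases i with _ | i
        · refine List.mem_cons.2 (.inl ?_)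
          rw [hw]
          simp [cycleVert_val]
        · refine List.mem_cons.2 (.inr ?_)
          have := h3 (by omega) i (by omega)
          have e : ∀ j, cycleVert (by omega : 0 < n) (w + j) =
              cycleVert (by omega : 0 < n) (u + 1 + j) := fun j =>
            (cycleVert_eq_iff _).2 (hmod'.add_right j)
          rw [show u.val + (i + 1) = u + 1 + i by ring, show u.val + 1 + i + 1 = u + 1 + (i + 1) by
            ring, ← e, ← e]
          exact this

/-- A rainbow path has at most as many edges as there are colours. -/
lemma IsRainbowPath.length_le {V : Type*} {G : SimpleGraph V} {k : ℕ} {c : G.EdgeLabeling (Fin k)}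
    {u v : V} {p : G.Walk u v} (h : IsRainbowPath c p) : p.length ≤ k := by
  have hnd : (p.edges.attach.map fun e => c ⟨e.1, p.edges_subset_edgeSet e.2⟩).Nodup := by
    refine List.Nodup.map_on ?_ (List.nodup_attach.2 h.1.isTrail.edges_nodup)
    intro e _ f _ hef
    have := h.2 ⟨e.1, p.edges_subset_edgeSet e.2⟩ ⟨f.1, p.edges_subset_edgeSet f.2⟩ e.2 f.2 hef
    exact Subtype.ext (by simpa using this)
  have := hnd.length_le_card
  simpa using this

/-- Fewer than `⌈n/2⌉` colours do not suffice for `C_n`. The distance between opposite vertices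
leaves only the case of `m` colours on `C_{2m+1}`. There any `m` consecutive edges have distinct
colours, so edges at distance `m` have equal colours; going round twice, two neighbouring edges
get equal colours. -/
lemma le_of_isRainbowConnected_cycleGraph (hn : 4 ≤ n) {k : ℕ}
    {c : (cycleGraph n).EdgeLabeling (Fin k)} (hc : IsRainbowConnected c) : (n + 1) / 2 ≤ k := by
  by_contra hk
  have hn0 : 0 < n := by omega
  set m := n / 2 with hm
  have key : ∀ i : ℕ, ∃ p : (cycleGraph n).Walk (cycleVert hn0 i) (cycleVert hn0 (i + m)),
      IsRainbowPath c p ∧ m ≤ k ∧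
        ∀ j < m, s(cycleVert hn0 (i + j), cycleVert hn0 (i + j + 1)) ∈ p.edges := by
    intro i
    obtain ⟨p, hp⟩ := hc (cycleVert hn0 i) (cycleVert hn0 (i + m))
    have hlen := hp.length_le
    obtain ⟨d, h1, h2, h3⟩ := exists_displacement (by omega) p
    rw [abs_le] at h1
    have e1 : ((cycleVert hn0 i : Fin n) : ℤ) ≡ i [ZMOD n] := by
      simp [cycleVert, Int.ModEq]
    have e2 : ((cycleVert hn0 (i + m) : Fin n) : ℤ) ≡ i + m [ZMOD n] := by
      simp [cycleVert, Int.ModEq]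
    have h4 : (i : ℤ) + d ≡ i + m [ZMOD n] := ((e1.symm.add_right d).trans h2).trans e2
    have h5 : d ≡ m [ZMOD n] := Int.ModEq.add_left_cancel' _ h4
    have h6 : (m : ℤ) - d = 0 := by
      refine Int.eq_zero_of_abs_lt_dvd (m := n) h5.dvd ?_
      rw [abs_lt]
      omega
    refine ⟨p, hp, by omega, fun j hj => ?_⟩
    have := h3 (by omega) j (by omega)
    have e : ∀ j, cycleVert hn0 ((cycleVert hn0 i : Fin n) + j) = cycleVert hn0 (i + j) := fun j =>
      (cycleVert_eq_iff _).2 ((Nat.mod_modEq i n).add_right j)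
    rw [e, add_assoc, e] at this
    rwa [add_assoc]
  have hmk : m ≤ k := (key 0).choose_spec.2.1
  clear_value m
  obtain rfl : k = m := by omega
  have hodd : n = 2 * k + 1 := by omega
  let C : ℕ → Fin k := fun j =>
    c ⟨s(cycleVert hn0 j, cycleVert hn0 (j + 1)), cycleGraph_adj_cycleVert (by omega) j⟩
  have hne : ∀ i a b, i ≤ a → a < b → b < i + k → C a ≠ C b := by
    intro i a b hia hab hb hC
    obtain ⟨p, hp, -, hpe⟩ := key i
    have ha := hpe (a - i) (by omega)
    have hb := hpe (b - i) (by omega)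
    rw [show i + (a - i) = a by omega] at ha
    rw [show i + (b - i) = b by omega] at hb
    have := congrArg Subtype.val (hp.2 ⟨_, cycleGraph_adj_cycleVert (by omega) a⟩
      ⟨_, cycleGraph_adj_cycleVert (by omega) b⟩ ha hb hC)
    rcases Sym2.eq_iff.1 this with ⟨h, -⟩ | ⟨h, -⟩
    · exact cycleVert_ne hn0 hab (by omega) h
    · exact cycleVert_ne hn0 (show a < b + 1 by omega) (by omega) h
  have hper : ∀ i, C (i + k) = C i := by
    intro i
    have hinj : Function.Injective fun j : Fin k => C (i + j) := by
      intro a b hab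
      rcases lt_trichotomy a b with h | h | h
      · exact absurd hab (hne i _ _ (by omega) (by simpa using h) (by omega))
      · exact h
      · exact absurd hab.symm (hne i _ _ (by omega) (by simpa using h) (by omega))
    obtain ⟨j, hj⟩ := (Finite.injective_iff_surjective.1 hinj) (C (i + k))
    by_cases hj0 : j.val = 0
    · rw [← hj]; simp [hj0]
    · exact absurd hj (hne (i + 1) _ _ (by omega) (by omega) (by omega))
  have hround : C (2 * k + 1) = C 0 := by
    have e : ∀ j, cycleVert hn0 (2 * k + 1 + j) = cycleVert hn0 j := fun j => by
      rw [cycleVert_eq_iff, ← hodd]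
      simp [Nat.ModEq]
    have e0 := e 0
    have e1 := e 1
    simp only [add_zero] at e0
    simp only [C, e0, e1, zero_add]
  refine hne (2 * k) (2 * k) (2 * k + 1) le_rfl (by omega) (by omega) ?_
  rw [hround, two_mul, hper, ← hper 0, zero_add]

end Cycle

end RainbowConnection

theorem theorem1 :
    (∀ (V : Type*) [Fintype V] (G : SimpleGraph V) (n : ℕ), Fintype.card V = n → 3 ≤ n →
      RainbowConnection.TwoConnected G →
        RainbowConnection.rc G ≤ ((⌈(n : ℚ) / 2⌉₊ : ℕ) : ℕ∞)) ∧
    (∀ n : ℕ, 4 ≤ n →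
      RainbowConnection.TwoConnected (SimpleGraph.cycleGraph n) ∧
        RainbowConnection.rc (SimpleGraph.cycleGraph n) = ((⌈(n : ℚ) / 2⌉₊ : ℕ) : ℕ∞)) := by
  refine ⟨fun V _ G n hn _ h => hn ▸ h.rc_le, fun n hn => ?_⟩
  have h2 := RainbowConnection.cycleGraph_twoConnected (show 3 ≤ n by omega)
  refine ⟨h2, le_antisymm (by simpa using h2.rc_le) ?_⟩
  refine le_iInf₂ fun k ⟨c, hc⟩ => ?_
  rw [RainbowConnection.ceil_half]
  exact_mod_cast RainbowConnection.le_of_isRainbowConnected_cycleGraph hn hc
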